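/- **Setting.** Let $S$ be the circle of length $2\pi$, parameterized by $s\in[0,2\pi)$. Let $J:\mathbb R\to\mathbb R$ be the convex piecewise linear function which on $[-\pi,\pi]$ equals $$J(\varphi)=\frac{\pi}{4}\Bigl(\bigl|\varphi-\tfrac{3\pi}{4}\bigr|+\bigl|\varphi-\tfrac{\pi}{4}\bigr|+\bigl|\varphi+\tfrac{\pi}{4}\bigr|+\bigl|\varphi+\tfrac{3\pi}{4}\bigr|\Bigr)$$ and which is extended so that $J'(\varphi+2\pi)=J'(\varphi)+2\pi$, i.e. $J(\varphi+2\pi)=J(\varphi)+2\pi\varphi+2\pi^2$; thus $J'$ jumps by $\frac\pi2$ at all angles congruent to $\pm\frac\pi4,\pm\frac{3\pi}4$ modulo $2\pi$. Let $\partial J$ be its subdifferential, let $TV(S)$ be the space of functions of bounded variation on $S$, and let $T>0$. A *weak solution* of $$\Lambda_t\in\frac{\partial}{\partial s}\,\partial J(\Lambda_s+s)\ \text{ in } S\times(0,T),\qquad \Lambda(\cdot,0)=\Lambda_0 \tag{1}$$ is a $\Lambda\in C([0,T];L_2(S))$ with $\Lambda(0)=\Lambda_0$ and $\Lambda_s\in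 L_\infty(0,T;TV(S))$ for which there is $\Omega\in L_1(0,T;W^1_1(0,2\pi))$ such that $\Omega(s,t)\in\partial J(\Lambda_s(s,t)+s)$ for a.e. $(s,t)$ and, for every $\eta\in C^\infty(S)$, $$\int_S\Lambda_t\,\eta\,ds=-\int_S(\Omega-s)\,\eta_s\,ds+\int_S\eta\,ds\quad\text{on }(0,T),$$ that is, for all $t\in[0,T]$, $$\int_S\Lambda(t)\eta\,ds-\int_S\Lambda(0)\eta\,ds=\int_0^t\Bigl(-\int_S(\Omega-s)\eta_s\,ds+\int_S\eta\,ds\Bigr)d\tau.$$ For $h>0$, a *solution of the semi-discretization* with step $h$ is a sequence $\lambda_h^0,\dots,\lambda_h^{[T/h]}$ of functions on $[0,2\pi]$ such that $\lambda^0_h=\Lambda_0$ and, for $1\le k\le[T/h]$, $\lambda^k_h$ is absolutely continuous on $[0,2\pi]$, $\lambda_h^k(0)=\lambda_h^k(2\pi)$, and there is an absolutely continuous $\omega$ on $[0,2\pi]$ with $\omega(2\pi)=\omega(0)+2\pi$ (so that $\omega-s$ is periodic), $\omega(s)\in\partial J(\lambda^k_{h,s}(s)+s)$ and $\dfrac{\lambda_h^k(s)-\lambda_h^{k-1}(s)}{h}=\omega_s(s)$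 for a.e. $s$. **Lemma.** Let $\Lambda$ be a weak solution of (1) and, for every $h>0$, let $\{\lambda^k_h\}$ be a solution of the semi-discretization with step $h$ and the same initial datum $\Lambda_0$. Put $\bar\lambda_h(s,t)=\sum_{k=0}^{[T/h]}\lambda_h^k(s)\,\chi_{[kh,(k+1)h)}(t)$. Then $$\|\Lambda-\bar\lambda_h\|_{L_1(0,T;L_2(S))}\to0\qquad\text{as }h\to0^+ .$$ If moreover $\Lambda_{0,s}\in TV(S)$, then for all $1\le p<\infty$ and $0<\varepsilon\le2$ $$\|\Lambda-\bar\lambda_h\|_{L_p(0,T;W_1^{2-\varepsilon}(S))}\to0\qquad\text{as }h\to0^+ ,$$ where, for non-integer order, $W^{2-\varepsilon}_1(S)$ is the Sobolev-Slobodeckij space: for $0<\theta<1$, $$\|g\|_{W^\theta_1(S)}=\|g\|_{L_1(S)}+\int_S\int_S\frac{|g(x)-g(y)|}{d_S(x,y)^{1+\theta}}\,dx\,dy,\qquad \|f\|_{W^{1+\theta}_1(S)}=\|f\|_{L_1(S)}+\|f_s\|_{W^{\theta}_1(S)},$$ with $d_S$ the geodesic distance on $S$. -/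

import Mathlib

open MeasureTheory Set Filter Topology
open scoped ENNReal

noncomputable section

namespace CurvatureFlow

/-! ### The energy density `J` and its subdifferential -/

/-- The sum of four absolute values, with corners at the angles `± π/4` and `± 3π/4`. -/
def J₀ (φ : ℝ) : ℝ :=
  Real.pi / 4 * (|φ - 3 * Real.pi / 4| + |φ - Real.pi / 4|
    + |φ + Real.pi / 4| + |φ + 3 * Real.pi / 4|)

/-- The energy density `J` as a function of the angle, the angle being a real number that grows by
`2π` along the circle.  It is the function equal to `J₀` on `[-π, π]` whose derivative grows by `2π`
when the angle grows by `2π` (so that its derivative jumps by `π/2` at each angle congruent to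
`± π/4` or `± 3π/4` modulo `2π`). -/
def J (φ : ℝ) : ℝ :=
  J₀ (φ - 2 * Real.pi * round (φ / (2 * Real.pi)))
    + 2 * Real.pi * round (φ / (2 * Real.pi)) * (φ - 2 * Real.pi * round (φ / (2 * Real.pi)))
    + 2 * Real.pi ^ 2 * (round (φ / (2 * Real.pi)) : ℝ) ^ 2

theorem J_add_two_pi (φ : ℝ) :
    J (φ + 2 * Real.pi) = J φ + 2 * Real.pi * φ + 2 * Real.pi ^ 2 := by
  have hpi := Real.pi_pos
  have h : (φ + 2 * Real.pi) / (2 * Real.pi) = φ / (2 * Real.pi) + 1 := by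
    field_simp
  have h2 : round (φ / (2 * Real.pi) + 1) = round (φ / (2 * Real.pi)) + 1 := by
    simp
  unfold J
  rw [h, h2]
  push_cast
  have e : φ + 2 * Real.pi - 2 * Real.pi * ((round (φ / (2 * Real.pi)) : ℝ) + 1)
      = φ - 2 * Real.pi * (round (φ / (2 * Real.pi)) : ℝ) := by ring
  rw [e]
  ring

/-- The subdifferential of `f` at `x`. -/
def subdiff (f : ℝ → ℝ) (x : ℝ) : Set ℝ := {ω | ∀ y, f x + ω * (y - x) ≤ f y}

/-! ### The unit circle `S`

Functions on `S` are functions on `(0, 2π]`, up to null sets; the topology of the circle enters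
through the `2π`-periodic smooth test functions. -/

/-- Arclength measure on `S`. -/
def circ : Measure ℝ := volume.restrict (Ioc 0 (2 * Real.pi))

/-- `C^∞(S)`. -/
def IsTest (η : ℝ → ℝ) : Prop :=
  ContDiff ℝ ((⊤ : ℕ∞) : WithTop ℕ∞) η ∧ Function.Periodic η (2 * Real.pi)

/-- `g` is the weak derivative of `f` on the circle `S`. -/
def HasWeakDeriv (f g : ℝ → ℝ) : Prop :=
  Integrable f circ ∧ Integrable g circ ∧
    ∀ η, IsTest η → ∫ s, f s * deriv η s ∂circ = -∫ s, g s * η s ∂circ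

/-- The norm of `TV(S)`: the `L_1` norm plus the essential variation on the circle. -/
def tvNorm (g : ℝ → ℝ) : ℝ≥0∞ :=
  eLpNorm g 1 circ +
    ⨅ (v : ℝ → ℝ) (_ : v =ᵐ[circ] g) (_ : v 0 = v (2 * Real.pi)),
      eVariationOn v (Icc 0 (2 * Real.pi))

/-- The geodesic distance on `S`. -/
def circDist (x y : ℝ) : ℝ := ‖((x - y : ℝ) : AddCircle (2 * Real.pi))‖

/-- The norm of the Sobolev-Slobodeckij space `W^θ_1(S)` for an order `0 ≤ θ < 1`. -/
def slobodeckijNorm (θ : ℝ) (g : ℝ → ℝ) : ℝ≥0∞ :=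
  eLpNorm g 1 circ +
    if 0 < θ then
      ∫⁻ x, ∫⁻ y, ENNReal.ofReal |g x - g y| / ENNReal.ofReal (circDist x y ^ (1 + θ)) ∂circ ∂circ
    else 0

/-- The norm of `W^σ_1(S)` for an order `0 ≤ σ < 2`; it is `⊤` outside the space. -/
def sobolevNorm (σ : ℝ) (f : ℝ → ℝ) : ℝ≥0∞ :=
  if σ < 1 then slobodeckijNorm σ f
  else eLpNorm f 1 circ + ⨅ (g : ℝ → ℝ) (_ : HasWeakDeriv f g), slobodeckijNorm (σ - 1) g

/-! ### Weak solutions -/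

/-- `Λ ∈ C([0,T]; L_2(S))` is a weak solution on `S × (0,T)` of
`Λ_t ∈ ∂_s ∂J(Λ_s + s)`, `Λ(·,0) = Λ₀`.  Here `Λs` is the derivative `Λ_s`, an element of
`L_∞(0,T; TV(S))`, and `Ω` is the selection of `∂J(Λ_s + s)`, with `Ω(·,t)` absolutely continuous
and `Ω`, `Ω_s` integrable on `S × (0,T)`.  The identity
`∫_S Λ_t η = - ∫_S (Ω - s) η_s + ∫_S η` is stated in its form integrated in time. -/
def IsWeakSolution (T : ℝ) (Λ₀ : ℝ → ℝ) (Λ : ℝ → Lp ℝ 2 circ) : Prop :=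
  ContinuousOn Λ (Icc 0 T) ∧ Λ 0 =ᵐ[circ] Λ₀ ∧
  ∃ Λs Ω : ℝ → ℝ → ℝ,
    AEStronglyMeasurable (fun z : ℝ × ℝ => Λs z.1 z.2) ((volume.restrict (Ioo 0 T)).prod circ) ∧
    (∀ᵐ t ∂(volume.restrict (Ioo 0 T)), HasWeakDeriv (Λ t) (Λs t)) ∧
    (∃ M : ℝ≥0∞, M < ⊤ ∧ ∀ᵐ t ∂(volume.restrict (Ioo 0 T)), tvNorm (Λs t) ≤ M) ∧
    Integrable (fun z : ℝ × ℝ => Ω z.1 z.2) ((volume.restrict (Ioo 0 T)).prod circ) ∧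
    (∀ᵐ t ∂(volume.restrict (Ioo 0 T)),
      AbsolutelyContinuousOnInterval (Ω t) 0 (2 * Real.pi)) ∧
    Integrable (fun z : ℝ × ℝ => deriv (Ω z.1) z.2) ((volume.restrict (Ioo 0 T)).prod circ) ∧
    (∀ᵐ z ∂((volume.restrict (Ioo 0 T)).prod circ), Ω z.1 z.2 ∈ subdiff J (Λs z.1 z.2 + z.2)) ∧
    ∀ η, IsTest η → ∀ t ∈ Icc 0 T,
      ∫ s, Λ t s * η s ∂circ - ∫ s, Λ 0 s * η s ∂circ =
        ∫ τ in 0..t, (-∫ s, (Ω τ s - s) * deriv η s ∂circ + ∫ s, η s ∂circ)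

/-! ### The semi-discretization in time -/

/-- `u` solves one implicit step of size `h` from `v`: it is absolutely continuous and periodic, and
`(u - v) / h = ω_s` with an absolutely continuous selection `ω` of `∂J(u_s + s)` such that `ω - s`
is periodic. -/
def IsImplicitStep (h : ℝ) (v u : ℝ → ℝ) : Prop :=
  AbsolutelyContinuousOnInterval u 0 (2 * Real.pi) ∧ u 0 = u (2 * Real.pi) ∧
  ∃ ω : ℝ → ℝ, AbsolutelyContinuousOnInterval ω 0 (2 * Real.pi) ∧
    ω (2 * Real.pi) = ω 0 + 2 * Real.pi ∧
    (∀ᵐ s ∂circ, ω s ∈ subdiff J (deriv u s + s)) ∧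
    ∀ᵐ s ∂circ, (u s - v s) / h = deriv ω s

/-- `lam 0, lam 1, …` is a solution of the semi-discretization with step `h` and datum `Λ₀`, up to
the index `[T/h]`. -/
def IsSemiDiscreteSolution (T h : ℝ) (Λ₀ : ℝ → ℝ) (lam : ℕ → ℝ → ℝ) : Prop :=
  lam 0 =ᵐ[circ] Λ₀ ∧ ∀ k : ℕ, 1 ≤ k → k ≤ ⌊T / h⌋₊ → IsImplicitStep h (lam (k - 1)) (lam k)

/-- The piecewise constant interpolant `∑_{k=0}^{[T/h]} lam k (s) χ_{[kh,(k+1)h)}(t)`. -/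
def interpolant (T h : ℝ) (lam : ℕ → ℝ → ℝ) (t s : ℝ) : ℝ :=
  ∑ k ∈ Finset.range (⌊T / h⌋₊ + 1), (Ico (k * h) ((k + 1) * h)).indicator (fun _ => lam k s) t

/-- `u h → 0` in `L_p(0,T; X)` as `h → 0⁺`, where `N` is the norm of `X` (and `⊤` outside `X`). -/
def TendstoZeroInLp (T p : ℝ) (N : (ℝ → ℝ) → ℝ≥0∞) (u : ℝ → ℝ → ℝ → ℝ) : Prop :=
  (∀ h, 0 < h → AEMeasurable (fun t => N (u h t)) (volume.restrict (Ioo 0 T))) ∧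
  Tendsto (fun h => (∫⁻ t in Ioo 0 T, N (u h t) ^ p) ^ (1 / p)) (𝓝[>] 0) (𝓝 0)

end CurvatureFlow

end

/-!
The Lemma rests on two estimates, neither of which uses more about `J` than the monotonicity of its
subdifferential and the relation `∂J(φ + 2π) = ∂J(φ) + 2π`.

*Error estimate.*  Testing the weak form against functions concentrating at `s = 0` shows that
`Ω - s` is periodic at almost every time, so that `Λ` has the time derivative `D = Ω_s` in
`L_1((0,T) × S)` (`exists_time_derivative`) and `u ↦ -∂_s ∂J(u_s + s)` acts monotonically on `Λ` and
on the discrete solution (`integral_deriv_sub_mul_sub_nonpos`).  Comparing `Λ` on a step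
`[t_{k-1}, t_k]` with `λ^k` gives
`‖Λ(t_k) - λ^k‖² ≤ ‖Λ(t_{k-1}) - λ^{k-1}‖² + h⁻¹ ∫ ‖Λ(τ) - Λ(t_{k-1})‖² dτ`
(`norm_sub_sq_step_le`).  The derivative `D` is only integrable, but `Λ_s` is bounded, and a small
function with bounded derivative is small in `L_∞`.  Hence
`‖Λ(b) - Λ(a)‖² ≤ δ ∫_a^b ∫_S |D|` as soon as `b - a` is small (`exists_norm_sub_sq_le`), and the
errors add up to at most `δ ∫_0^T ∫_S |D|`.  The convergence in `L_2(S)` is thus uniform in time.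

*Regularity of the discrete solution.*  The angle `w = λ^k_s + s` solves an implicit step of
`w_t = (∂J(w))_ss`, which contracts `L_1` distances.  Applied to `w` and its translate by `a`, this
bounds `∫ |w(x + a) - w(x)| dx` by its value for the initial datum (`angleMod_le_of_step`), which is
`O(|a|)` if `Λ_{0,s} ∈ TV(S)`.  So the derivatives of the error have a common Lipschitz modulus of
continuity in `L_1(S)`.  Interpolation with the smallness of the error itself makes the derivatives
small in `L_1(S)` and then, since `min (C |a|) A ≤ (C |a|)^(1-β) A^β`, small in `W^θ_1(S)` for every
`θ < 1` (`exists_sobolevNorm_le`).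
-/

namespace CurvatureFlow

/-! ### Periodic extension and translations on the circle -/

/-- The `2π`-periodic function that agrees with `f` on `(0, 2π]`. -/
noncomputable def perExt (f : ℝ → ℝ) (x : ℝ) : ℝ := f (toIocMod Real.two_pi_pos 0 x)

theorem perExt_periodic (f : ℝ → ℝ) : Function.Periodic (perExt f) (2 * Real.pi) := by
  intro x
  simp [perExt]

theorem perExt_of_mem (f : ℝ → ℝ) {x : ℝ} (hx : x ∈ Ioc 0 (2 * Real.pi)) : perExt f x = f x := by
  have : toIocMod Real.two_pi_pos 0 x = x := by
    rw [toIocMod_eq_self]; simpa using hx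
  simp [perExt, this]

theorem perExt_sub (f g : ℝ → ℝ) (x : ℝ) :
    perExt (fun s => f s - g s) x = perExt f x - perExt g x := rfl

instance : IsFiniteMeasure circ := by unfold circ; infer_instance

theorem circ_univ : circ univ = ENNReal.ofReal (2 * Real.pi) := by
  simp [circ]

theorem circ_real_univ : circ.real univ = 2 * Real.pi := by
  rw [Measure.real, circ_univ, ENNReal.toReal_ofReal Real.two_pi_pos.le]

theorem ae_circ_iff {P : ℝ → Prop} :
    (∀ᵐ s ∂circ, P s) ↔ ∀ᵐ s, s ∈ Ioc 0 (2 * Real.pi) → P s := by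
  unfold circ; exact ae_restrict_iff' measurableSet_Ioc

theorem ae_circ_mem : ∀ᵐ s ∂circ, s ∈ Ioc 0 (2 * Real.pi) := ae_restrict_mem measurableSet_Ioc

theorem perExt_ae_eq (f : ℝ → ℝ) : perExt f =ᵐ[circ] f := by
  filter_upwards [ae_circ_mem] with s hs using perExt_of_mem f hs

theorem integral_circ (f : ℝ → ℝ) : ∫ s, f s ∂circ = ∫ s in 0..2 * Real.pi, f s := by
  rw [intervalIntegral.integral_of_le Real.two_pi_pos.le, circ]

theorem integrable_circ_iff {f : ℝ → ℝ} :
    Integrable f circ ↔ IntervalIntegrable f volume 0 (2 * Real.pi) := by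
  rw [intervalIntegrable_iff_integrableOn_Ioc_of_le Real.two_pi_pos.le]; rfl

theorem lintegral_periodic {G : ℝ → ℝ≥0∞} (hG : Function.Periodic G (2 * Real.pi)) (t : ℝ) :
    ∫⁻ x in Ioc t (t + 2 * Real.pi), G x = ∫⁻ x, G x ∂circ := by
  have : Fact (0 < 2 * Real.pi) := ⟨Real.two_pi_pos⟩
  have h := fun t => AddCircle.lintegral_preimage (2 * Real.pi) t hG.lift
  simp only [Function.Periodic.lift_coe] at h
  rw [h t, ← h 0, zero_add, circ]

theorem lintegral_circ_shift {G : ℝ → ℝ≥0∞} (hG : Function.Periodic G (2 * Real.pi)) (a : ℝ) :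
    ∫⁻ x, G (x + a) ∂circ = ∫⁻ x, G x ∂circ := by
  have h := (measurePreserving_add_right volume a).setLIntegral_comp_preimage_emb
    (measurableEmbedding_addRight a) G (Ioc a (a + 2 * Real.pi))
  have h2 : (fun x => x + a) ⁻¹' Ioc a (a + 2 * Real.pi) = Ioc 0 (2 * Real.pi) := by
    ext x; simp [add_comm a]
  rw [h2, lintegral_periodic hG a] at h
  exact h

theorem ae_of_ae_circ {P : ℝ → Prop} (hP : ∀ x, P (x + 2 * Real.pi) ↔ P x)
    (h : ∀ᵐ x ∂circ, P x) : ∀ᵐ x, P x := by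
  have hz : ∀ (n : ℤ) (x : ℝ), P (x + n • (2 * Real.pi)) ↔ P x := by
    intro n
    induction n with
    | zero => simp
    | succ n ih =>
      intro x
      rw [← ih x, ← hP (x + (n : ℤ) • (2 * Real.pi))]
      apply iff_of_eq; congr 1; push_cast [zsmul_eq_mul]; ring
    | pred n ih =>
      intro x
      rw [← ih x, ← hP (x + (-(n : ℤ) - 1) • (2 * Real.pi))]
      apply iff_of_eq; congr 1; push_cast [zsmul_eq_mul]; ring
  rw [ae_iff]
  have hsub : {x | ¬ P x} ⊆ ⋃ n : ℤ, (fun x => x + n • (2 * Real.pi)) ⁻¹'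
      ({x | ¬ P x} ∩ Ioc 0 (2 * Real.pi)) := by
    intro x hx
    obtain ⟨n, hn, -⟩ := existsUnique_add_zsmul_mem_Ioc Real.two_pi_pos x 0
    refine mem_iUnion.2 ⟨n, ?_, by simpa using hn⟩
    exact fun h' => hx ((hz n x).1 h')
  refine measure_mono_null hsub (measure_iUnion_null fun n => ?_)
  rw [measure_preimage_add_right]
  have h0 := ae_iff.1 h
  rwa [circ, Measure.restrict_apply₀' measurableSet_Ioc.nullMeasurableSet] at h0

theorem ae_circ_of_ae {P : ℝ → Prop} (h : ∀ᵐ x, P x) : ∀ᵐ x ∂circ, P x :=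
  ae_restrict_of_ae h

theorem ae_shift {P : ℝ → Prop} (h : ∀ᵐ x, P x) (a : ℝ) : ∀ᵐ x, P (x + a) :=
  (measurePreserving_add_right volume a).quasiMeasurePreserving.ae h

theorem perExt_intervalIntegrable {g : ℝ → ℝ} (hg : Integrable g circ) (a b : ℝ) :
    IntervalIntegrable (perExt g) volume a b := by
  refine (perExt_periodic g).intervalIntegrable₀ Real.two_pi_pos.ne' ?_ a b
  exact integrable_circ_iff.1 (hg.congr (perExt_ae_eq g).symm)

theorem locallyIntegrable_of_intervalIntegrable {g : ℝ → ℝ}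
    (hg : ∀ a b, IntervalIntegrable g volume a b) : LocallyIntegrable g volume := by
  intro x
  refine ⟨Icc (x - 1) (x + 1), Icc_mem_nhds (by linarith) (by linarith), ?_⟩
  rw [integrableOn_Icc_iff_integrableOn_Ioc]
  exact (intervalIntegrable_iff_integrableOn_Ioc_of_le (by linarith)).1 (hg _ _)

theorem perExt_locallyIntegrable {g : ℝ → ℝ} (hg : Integrable g circ) :
    LocallyIntegrable (perExt g) volume :=
  locallyIntegrable_of_intervalIntegrable (perExt_intervalIntegrable hg)

theorem perExt_aestronglyMeasurable {g : ℝ → ℝ} (hg : Integrable g circ) :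
    AEStronglyMeasurable (perExt g) volume :=
  (perExt_locallyIntegrable hg).aestronglyMeasurable

theorem perExt_congr_ae {f g : ℝ → ℝ} (h : f =ᵐ[circ] g) : perExt f =ᵐ[volume] perExt g := by
  refine ae_of_ae_circ (P := fun x => perExt f x = perExt g x)
    (fun x => by rw [perExt_periodic f x, perExt_periodic g x]) ?_
  filter_upwards [h, perExt_ae_eq f, perExt_ae_eq g] with s h1 h2 h3
  rw [h2, h3, h1]

/-- The integral `∫_S |g(x + a) - g(x)| dx`, the `L_1` modulus of continuity of `g`. -/
noncomputable def transMod (g : ℝ → ℝ) (a : ℝ) : ℝ≥0∞ :=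
  ∫⁻ x, ‖perExt g (x + a) - perExt g x‖ₑ ∂circ

theorem transMod_neg (g : ℝ → ℝ) (a : ℝ) : transMod g (-a) = transMod g a := by
  have hp : Function.Periodic (fun x => ‖perExt g (x + a) - perExt g x‖ₑ) (2 * Real.pi) := by
    intro x
    have : x + 2 * Real.pi + a = (x + a) + 2 * Real.pi := by ring
    simp only [this, perExt_periodic g _]
  rw [transMod, transMod, ← lintegral_circ_shift hp (-a)]
  refine lintegral_congr fun x => ?_
  rw [← enorm_neg]
  congr 1
  ring_nf

theorem transMod_abs (g : ℝ → ℝ) (a : ℝ) : transMod g |a| = transMod g a := by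
  rcases abs_choice a with h | h <;> rw [h]
  exact transMod_neg g a

theorem enorm_perExt_periodic (g : ℝ → ℝ) :
    Function.Periodic (fun x => ‖perExt g x‖ₑ) (2 * Real.pi) := fun x => by
  simp only [perExt_periodic g x]

theorem lintegral_enorm_perExt (g : ℝ → ℝ) :
    ∫⁻ x, ‖perExt g x‖ₑ ∂circ = eLpNorm g 1 circ := by
  rw [eLpNorm_one_eq_lintegral_enorm]
  exact lintegral_congr_ae ((perExt_ae_eq g).fun_comp (‖·‖ₑ))

theorem perExt_shift_aestronglyMeasurable {g : ℝ → ℝ} (hg : Integrable g circ) (a : ℝ) :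
    AEStronglyMeasurable (fun x => perExt g (x + a)) volume :=
  (perExt_aestronglyMeasurable hg).comp_quasiMeasurePreserving
    (measurePreserving_add_right volume a).quasiMeasurePreserving

theorem transMod_le_two {g : ℝ → ℝ} (hg : Integrable g circ) (a : ℝ) :
    transMod g a ≤ 2 * eLpNorm g 1 circ := by
  calc transMod g a ≤ ∫⁻ x, (‖perExt g (x + a)‖ₑ + ‖perExt g x‖ₑ) ∂circ :=
        lintegral_mono fun x => enorm_sub_le
    _ = ∫⁻ x, ‖perExt g (x + a)‖ₑ ∂circ + ∫⁻ x, ‖perExt g x‖ₑ ∂circ :=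
        lintegral_add_left' (perExt_shift_aestronglyMeasurable hg a).restrict.enorm _
    _ = 2 * eLpNorm g 1 circ := by
        rw [lintegral_circ_shift (enorm_perExt_periodic g) a, lintegral_enorm_perExt, two_mul]

theorem transMod_sub_le {f g : ℝ → ℝ} (hf : Integrable f circ) (a : ℝ) :
    transMod (fun s => f s - g s) a ≤ transMod f a + transMod g a := by
  have hm : AEMeasurable (fun x => ‖perExt f (x + a) - perExt f x‖ₑ) circ :=
    ((perExt_shift_aestronglyMeasurable hf a).sub (perExt_aestronglyMeasurable hf)).restrict.enorm
  rw [transMod, transMod, transMod, ← lintegral_add_left' hm]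
  refine lintegral_mono fun x => ?_
  simp only [perExt_sub]
  calc ‖perExt f (x + a) - perExt g (x + a) - (perExt f x - perExt g x)‖ₑ
      = ‖(perExt f (x + a) - perExt f x) - (perExt g (x + a) - perExt g x)‖ₑ := by
        congr 1; ring
    _ ≤ _ := enorm_sub_le

theorem transMod_congr_ae {f g : ℝ → ℝ} (h : f =ᵐ[circ] g) (a : ℝ) :
    transMod f a = transMod g a := by
  have h1 := perExt_congr_ae h
  refine lintegral_congr_ae (ae_circ_of_ae ?_)
  filter_upwards [h1, ae_shift h1 a] with x hx hxa
  rw [hx, hxa]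

/-! ### Weak derivatives on the circle -/

theorem contDiff_perExt {g : ℝ → ℝ} (hg : ContDiff ℝ ((⊤ : ℕ∞) : WithTop ℕ∞) g)
    (hs : tsupport g ⊆ Ioo 0 (2 * Real.pi)) :
    ContDiff ℝ ((⊤ : ℕ∞) : WithTop ℕ∞) (perExt g) := by
  have hpi := Real.two_pi_pos
  have key : ∀ y ∈ Ioc 0 (2 * Real.pi),
      ContDiffAt ℝ ((⊤ : ℕ∞) : WithTop ℕ∞) (perExt g) y := by
    intro y hy
    rcases hy.2.lt_or_eq with h | h
    · refine hg.contDiffAt.congr_of_eventuallyEq ?_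
      filter_upwards [Ioo_mem_nhds hy.1 h] with z hz
      exact perExt_of_mem g ⟨hz.1, hz.2.le⟩
    · have h0 : g =ᶠ[𝓝 0] 0 := notMem_tsupport_iff_eventuallyEq.1 fun h' => by
        simpa using (hs h').1
      have h1 : g =ᶠ[𝓝 y] 0 := notMem_tsupport_iff_eventuallyEq.1 fun h' => by
        have := (hs h').2; linarith
      have ht : Tendsto (fun z => z - 2 * Real.pi) (𝓝 y) (𝓝 0) := by
        have : Tendsto (fun z => z - 2 * Real.pi) (𝓝 y) (𝓝 (y - 2 * Real.pi)) :=
          (continuous_sub_right _).tendsto y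
        rwa [show y - 2 * Real.pi = 0 by linarith] at this
      refine (contDiffAt_const (c := (0 : ℝ))).congr_of_eventuallyEq ?_
      filter_upwards [h1, ht.eventually h0, Ioo_mem_nhds hy.1 (show y < 4 * Real.pi by linarith)]
        with z hz1 hz2 hz3
      rcases le_or_gt z (2 * Real.pi) with hz | hz
      · rw [perExt_of_mem g ⟨hz3.1, hz⟩, hz1]; rfl
      · rw [← (perExt_periodic g).sub_eq, perExt_of_mem g ⟨by linarith, by linarith [hz3.2]⟩, hz2]
        rfl
  rw [contDiff_iff_contDiffAt]
  intro x
  obtain ⟨n, hn, -⟩ := existsUnique_add_zsmul_mem_Ioc Real.two_pi_pos x 0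
  have e : perExt g = perExt g ∘ fun z => z + n • (2 * Real.pi) := by
    funext z; exact ((perExt_periodic g).zsmul n z).symm
  rw [e]
  exact (key _ (by simpa using hn)).comp x (contDiffAt_id.add contDiffAt_const)

theorem IsTest.continuous {η : ℝ → ℝ} (hη : IsTest η) : Continuous η := hη.1.continuous

theorem IsTest.absCont {η : ℝ → ℝ} (hη : IsTest η) (a b : ℝ) :
    AbsolutelyContinuousOnInterval η a b :=
  (hη.1.of_le (by exact_mod_cast le_top)).contDiffOn.absolutelyContinuousOnInterval

theorem IsTest.zero_eq {η : ℝ → ℝ} (hη : IsTest η) : η (2 * Real.pi) = η 0 := by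
  have := hη.2 0; rwa [zero_add] at this

theorem isTest_const (c : ℝ) : IsTest fun _ => c := ⟨contDiff_const, fun _ => rfl⟩

theorem integrable_mul_continuous {f η : ℝ → ℝ} (hf : Integrable f circ)
    (hη : ContinuousOn η (Icc 0 (2 * Real.pi))) : Integrable (fun s => f s * η s) circ := by
  rw [integrable_circ_iff] at *
  refine hf.mul_continuousOn ?_
  rwa [uIcc_of_le Real.two_pi_pos.le]

/-- The fundamental lemma of the calculus of variations on the circle. -/
theorem ae_eq_zero_of_test {f : ℝ → ℝ} (hf : Integrable f circ)
    (h : ∀ η, IsTest η → ∫ s, f s * η s ∂circ = 0) : f =ᵐ[circ] 0 := by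
  have h1 : ∀ᵐ x, x ∈ Ioo 0 (2 * Real.pi) → f x = 0 := by
    refine isOpen_Ioo.ae_eq_zero_of_integral_contDiff_smul_eq_zero
      (IntegrableOn.locallyIntegrableOn (hf.mono_measure
        (Measure.restrict_mono Ioo_subset_Ioc_self le_rfl))) ?_
    intro g hg _ hgs
    have ht := h (perExt g) ⟨contDiff_perExt hg hgs, perExt_periodic g⟩
    have e1 : ∫ s, f s * perExt g s ∂circ = ∫ s, f s * g s ∂circ := by
      refine integral_congr_ae ?_
      filter_upwards [perExt_ae_eq g] with s hs
      rw [hs]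
    rw [e1, circ] at ht
    rw [← ht, ← setIntegral_eq_integral_of_forall_compl_eq_zero (s := Ioc 0 (2 * Real.pi))]
    · simp [mul_comm]
    · intro x hx
      have : g x = 0 := image_eq_zero_of_notMem_tsupport fun h' => hx (Ioo_subset_Ioc_self (hgs h'))
      simp [this]
  rw [EventuallyEq, ae_circ_iff]
  have h2 : ∀ᵐ x : ℝ, x ≠ 2 * Real.pi := by simp [ae_iff, measure_singleton]
  filter_upwards [h1, h2] with x hx hx2 hm
  exact hx ⟨hm.1, lt_of_le_of_ne hm.2 hx2⟩

/-- `F` is a `2π`-periodic locally absolutely continuous function with periodic derivative `p`. -/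
structure IsPeriodicPrimitive (F p : ℝ → ℝ) : Prop where
  periodic_deriv : Function.Periodic p (2 * Real.pi)
  integrable : ∀ a b, IntervalIntegrable p volume a b
  periodic : Function.Periodic F (2 * Real.pi)
  sub_eq : ∀ a b, F b - F a = ∫ x in a..b, p x

namespace IsPeriodicPrimitive

variable {F p : ℝ → ℝ}

theorem eq_integral (h : IsPeriodicPrimitive F p) (a : ℝ) :
    F = fun x => F a + ∫ r in a..x, p r := by
  funext x; rw [← h.sub_eq]; ring

theorem absCont (h : IsPeriodicPrimitive F p) (a b : ℝ) :
    AbsolutelyContinuousOnInterval F a b := by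
  rw [h.eq_integral a]
  exact (LipschitzWith.const (F a)).lipschitzOnWith.absolutelyContinuousOnInterval.add
    ((h.integrable a b).absolutelyContinuousOnInterval_intervalIntegral left_mem_uIcc)

theorem ae_hasDerivAt (h : IsPeriodicPrimitive F p) : ∀ᵐ x, HasDerivAt F (p x) x := by
  have hl : LocallyIntegrable p volume := locallyIntegrable_of_intervalIntegrable h.integrable
  filter_upwards [LocallyIntegrable.ae_hasDerivAt_integral hl] with x hx
  rw [h.eq_integral 0]
  exact (hx 0).const_add _

theorem ae_deriv_eq (h : IsPeriodicPrimitive F p) : ∀ᵐ x, deriv F x = p x := by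
  filter_upwards [h.ae_hasDerivAt] with x hx using hx.deriv

theorem continuous (h : IsPeriodicPrimitive F p) : Continuous F := by
  rw [h.eq_integral 0]
  exact continuous_const.add (intervalIntegral.continuous_primitive h.integrable 0)

theorem zero_eq (h : IsPeriodicPrimitive F p) : F (2 * Real.pi) = F 0 := by
  have := h.periodic 0; rwa [zero_add] at this

end IsPeriodicPrimitive

theorem hasWeakDeriv_of_absCont {u : ℝ → ℝ}
    (hu : AbsolutelyContinuousOnInterval u 0 (2 * Real.pi)) (h0 : u 0 = u (2 * Real.pi)) :
    HasWeakDeriv u (deriv u) := by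
  refine ⟨?_, integrable_circ_iff.2 hu.intervalIntegrable_deriv, fun η hη => ?_⟩
  · exact integrable_circ_iff.2 hu.continuousOn.intervalIntegrable
  · rw [integral_circ, integral_circ, hu.integral_mul_deriv_eq_deriv_mul (hη.absCont _ _),
      hη.zero_eq, h0]
    ring

theorem HasWeakDeriv.sub {f g f' g' : ℝ → ℝ} (hf : HasWeakDeriv f f') (hg : HasWeakDeriv g g') :
    HasWeakDeriv (fun s => f s - g s) (fun s => f' s - g' s) := by
  refine ⟨hf.1.sub hg.1, hf.2.1.sub hg.2.1, fun η hη => ?_⟩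
  have hc : Continuous (deriv η) := hη.1.continuous_deriv (by exact_mod_cast le_top)
  simp only [sub_mul]
  rw [integral_sub (integrable_mul_continuous hf.1 hc.continuousOn)
      (integrable_mul_continuous hg.1 hc.continuousOn),
    integral_sub (integrable_mul_continuous hf.2.1 hη.continuous.continuousOn)
      (integrable_mul_continuous hg.2.1 hη.continuous.continuousOn), hf.2.2 η hη, hg.2.2 η hη]
  ring

theorem HasWeakDeriv.congr {f g f' g' : ℝ → ℝ} (hf : HasWeakDeriv f f') (h : f =ᵐ[circ] g)
    (h' : f' =ᵐ[circ] g') : HasWeakDeriv g g' := by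
  refine ⟨hf.1.congr h, hf.2.1.congr h', fun η hη => ?_⟩
  have e1 : ∫ s, f s * deriv η s ∂circ = ∫ s, g s * deriv η s ∂circ :=
    integral_congr_ae (h.mul (ae_eq_refl (deriv η)))
  have e2 : ∫ s, f' s * η s ∂circ = ∫ s, g' s * η s ∂circ :=
    integral_congr_ae (h'.mul (ae_eq_refl η))
  rw [← e1, ← e2]
  exact hf.2.2 η hη

theorem HasWeakDeriv.unique {f g g' : ℝ → ℝ} (h : HasWeakDeriv f g) (h' : HasWeakDeriv f g') :
    g =ᵐ[circ] g' := by
  have : (fun s => g s - g' s) =ᵐ[circ] 0 := by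
    refine ae_eq_zero_of_test (h.2.1.sub h'.2.1) fun η hη => ?_
    have := (h.sub h').2.2 η hη
    simp only [sub_self, zero_mul, integral_zero] at this
    linarith
  filter_upwards [this] with s hs
  exact sub_eq_zero.1 hs

/-- The du Bois-Reymond lemma: a function with a weak derivative on the circle is almost everywhere
equal to a periodic primitive of that derivative. -/
theorem HasWeakDeriv.exists_primitive {f g : ℝ → ℝ} (h : HasWeakDeriv f g) :
    ∃ F, IsPeriodicPrimitive F (perExt g) ∧ F =ᵐ[circ] f := by
  have hpi := Real.two_pi_pos
  have hint := perExt_intervalIntegrable h.2.1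
  have hmean : ∫ s in 0..2 * Real.pi, perExt g s = 0 := by
    rw [← integral_circ, integral_congr_ae (perExt_ae_eq g)]
    have := h.2.2 _ (isTest_const 1)
    simp only [deriv_const', mul_zero, integral_zero, mul_one] at this
    linarith
  have hP : ∀ c : ℝ, IsPeriodicPrimitive (fun x => c + ∫ s in 0..x, perExt g s) (perExt g) := by
    intro c
    refine ⟨perExt_periodic g, hint, fun x => ?_, fun a b => ?_⟩
    · have := (perExt_periodic g).intervalIntegral_add_eq x 0
      rw [zero_add, hmean] at this
      have e := intervalIntegral.integral_add_adjacent_intervals (hint 0 x)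
        (hint x (x + 2 * Real.pi))
      rw [← e, this, add_zero]
    · have e := intervalIntegral.integral_add_adjacent_intervals (hint 0 a) (hint a b)
      rw [← e]; ring
  set F₀ : ℝ → ℝ := fun x => 0 + ∫ s in 0..x, perExt g s with hF₀
  have hF := hP 0
  have hFi : Integrable F₀ circ := integrable_circ_iff.2 (hF.continuous.intervalIntegrable _ _)
  -- `f - F₀` annihilates the derivative of every test function
  have hder : ∀ η, IsTest η → ∫ s, (f s - F₀ s) * deriv η s ∂circ = 0 := by
    intro η hη
    have hw : HasWeakDeriv F₀ g := by
      refine (hasWeakDeriv_of_absCont (hF.absCont _ _) hF.zero_eq.symm).congr (ae_eq_refl _) ?_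
      filter_upwards [ae_circ_of_ae hF.ae_deriv_eq, perExt_ae_eq g] with s h1 h2
      rw [h1, h2]
    have := (h.sub hw).2.2 η hη
    simpa using this
  set c : ℝ := (2 * Real.pi)⁻¹ * ∫ s, (f s - F₀ s) ∂circ with hc
  refine ⟨_, hP c, ?_⟩
  have hG : Integrable (fun s => f s - F₀ s) circ := h.1.sub hFi
  have hz : (fun s => f s - F₀ s - c) =ᵐ[circ] 0 := by
    refine ae_eq_zero_of_test (hG.sub (integrable_const c)) fun ψ hψ => ?_
    set m : ℝ := (2 * Real.pi)⁻¹ * ∫ s in 0..2 * Real.pi, ψ s with hm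
    have hψi : ∀ a b, IntervalIntegrable ψ volume a b := hψ.continuous.intervalIntegrable
    have hcont : Continuous fun s => ψ s - m := hψ.continuous.sub continuous_const
    have hd : ∀ x, HasDerivAt (fun x => ∫ s in 0..x, (ψ s - m)) (ψ x - m) x := fun x =>
      (hcont.integral_hasStrictDerivAt 0 x).hasDerivAt
    have hderiv : deriv (fun x => ∫ s in 0..x, (ψ s - m)) = fun x => ψ x - m :=
      funext fun x => (hd x).deriv
    have htest : IsTest fun x => ∫ s in 0..x, (ψ s - m) := by
      refine ⟨?_, fun x => ?_⟩
      · refine contDiff_infty_iff_deriv.2 ⟨fun x => (hd x).differentiableAt, ?_⟩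
        rw [hderiv]
        exact hψ.1.sub contDiff_const
      · have hper : Function.Periodic (fun s => ψ s - m) (2 * Real.pi) := fun x => by
          simp only [hψ.2 x]
        have e1 := hper.intervalIntegral_add_eq x 0
        have e2 : ∫ s in 0..2 * Real.pi, (ψ s - m) = 0 := by
          rw [intervalIntegral.integral_sub (hψi _ _) (by simp)]
          simp only [intervalIntegral.integral_const, sub_zero, smul_eq_mul, hm]
          field_simp; ring
        rw [zero_add, e2] at e1
        have e := intervalIntegral.integral_add_adjacent_intervals
          (hcont.intervalIntegrable (μ := volume) 0 x)
          (hcont.intervalIntegrable (μ := volume) x (x + 2 * Real.pi))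
        simp only
        rw [← e, e1, add_zero]
    have h1 := hder _ htest
    rw [hderiv] at h1
    have hGψ := integrable_mul_continuous hG hψ.continuous.continuousOn
    have hψc : Integrable ψ circ := integrable_circ_iff.2 (hψi _ _)
    have h2 : ∫ s, (f s - F₀ s) * (ψ s - m) ∂circ
        = ∫ s, (f s - F₀ s) * ψ s ∂circ - (∫ s, (f s - F₀ s) ∂circ) * m := by
      simp only [mul_sub]
      rw [integral_sub hGψ (hG.mul_const m), integral_mul_const]
    have h3 : ∫ s, (f s - F₀ s - c) * ψ s ∂circ
        = ∫ s, (f s - F₀ s) * ψ s ∂circ - c * ∫ s, ψ s ∂circ := by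
      simp only [sub_mul _ c]
      rw [integral_sub hGψ (hψc.const_mul c), integral_const_mul]
    rw [h3, integral_circ ψ]
    rw [h2] at h1
    rw [hm] at h1
    rw [hc]
    linear_combination h1
  filter_upwards [hz] with s hs
  simp only [Pi.zero_apply, hF₀] at hs
  linarith

/-- A sup bound for a function on the circle with bounded derivative, in terms of its integral
norms. -/
theorem HasWeakDeriv.ae_sq_le {f g : ℝ → ℝ} (h : HasWeakDeriv f g) {L : ℝ}
    (hL : ∀ᵐ s ∂circ, |g s| ≤ L) :
    ∀ᵐ s ∂circ, f s ^ 2 ≤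
      (2 * Real.pi)⁻¹ * ∫ r, f r ^ 2 ∂circ + 2 * L * ∫ r, |f r| ∂circ := by
  have hpi := Real.two_pi_pos
  obtain ⟨F, hF, hFf⟩ := h.exists_primitive
  have hFi : Integrable (fun r => |F r|) circ :=
    integrable_circ_iff.2 (hF.continuous.abs.intervalIntegrable _ _)
  have hF2 : Integrable (fun r => F r ^ 2) circ :=
    integrable_circ_iff.2 ((hF.continuous.pow 2).intervalIntegrable _ _)
  have hL0 : 0 ≤ L := by
    have : (ae circ).NeBot := by
      rw [ae_neBot]; intro h0
      have := circ_univ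
      rw [h0] at this
      simp at this; linarith
    obtain ⟨s, hs⟩ := hL.exists
    exact (abs_nonneg _).trans hs
  have key : ∀ x ∈ Icc 0 (2 * Real.pi), ∀ y ∈ Icc 0 (2 * Real.pi),
      F x ^ 2 ≤ F y ^ 2 + 2 * L * ∫ r, |F r| ∂circ := by
    intro x hx y hy
    have hAC := (hF.absCont y x)
    have e := hAC.integral_deriv_mul_eq_sub hAC
    have hb : ‖∫ r in y..x, (deriv F r * F r + F r * deriv F r)‖ ≤
        ∫ r in uIoc y x, 2 * L * |F r| := by
      refine (intervalIntegral.norm_integral_le_integral_norm_uIoc).trans ?_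
      refine integral_mono_ae ?_ ?_ ?_
      · refine Integrable.norm ?_
        have h1 := (hF.absCont y x).intervalIntegrable_deriv.mul_continuousOn
          hF.continuous.continuousOn
        have h2 := (hF.absCont y x).intervalIntegrable_deriv.continuousOn_mul
          hF.continuous.continuousOn
        exact intervalIntegrable_iff.1 (h1.add h2)
      · exact intervalIntegrable_iff.1
          ((hF.continuous.abs.const_mul (2 * L)).intervalIntegrable _ _)
      · have hsub : uIoc y x ⊆ Ioc 0 (2 * Real.pi) := by
          rw [uIoc]; exact Ioc_subset_Ioc (le_min hy.1 hx.1) (max_le hy.2 hx.2)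
        have hg : ∀ᵐ r ∂circ, |deriv F r| ≤ L := by
          filter_upwards [hL, ae_circ_of_ae hF.ae_deriv_eq, perExt_ae_eq g] with r h1 h2 h3
          rw [h2, h3]; exact h1
        have hg' : ∀ᵐ r ∂(volume.restrict (uIoc y x)), |deriv F r| ≤ L :=
          ae_mono (Measure.restrict_mono hsub le_rfl) hg
        filter_upwards [hg'] with r hr
        rw [Real.norm_eq_abs, mul_comm (F r), ← two_mul, abs_mul, abs_mul, abs_two, ← mul_assoc]
        gcongr
    have hb2 : ∫ r in uIoc y x, 2 * L * |F r| ≤ 2 * L * ∫ r, |F r| ∂circ := by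
      rw [integral_const_mul]
      refine mul_le_mul_of_nonneg_left ?_ (by linarith)
      have hsub : uIoc y x ⊆ Ioc 0 (2 * Real.pi) := by
        rw [uIoc]; exact Ioc_subset_Ioc (le_min hy.1 hx.1) (max_le hy.2 hx.2)
      exact integral_mono_measure (Measure.restrict_mono hsub le_rfl)
        (Eventually.of_forall fun r => abs_nonneg _) hFi
    rw [e, Real.norm_eq_abs] at hb
    have := (le_abs_self _).trans (hb.trans hb2)
    nlinarith
  have e1 : ∫ r, F r ^ 2 ∂circ = ∫ r, f r ^ 2 ∂circ := by
    refine integral_congr_ae ?_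
    filter_upwards [hFf] with r hr; rw [hr]
  have e2 : ∫ r, |F r| ∂circ = ∫ r, |f r| ∂circ := by
    refine integral_congr_ae ?_
    filter_upwards [hFf] with r hr; rw [hr]
  filter_upwards [ae_circ_mem, hFf] with s hs hsf
  rw [← hsf, ← e1, ← e2]
  have h3 : ∫ _ : ℝ, F s ^ 2 ∂circ ≤ ∫ y, (F y ^ 2 + 2 * L * ∫ r, |F r| ∂circ) ∂circ := by
    refine integral_mono_ae (integrable_const _) (hF2.add (integrable_const _)) ?_
    filter_upwards [ae_circ_mem] with y hy
    exact key s (Ioc_subset_Icc_self hs) y (Ioc_subset_Icc_self hy)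
  rw [integral_add hF2 (integrable_const _), integral_const, integral_const, circ_real_univ,
    smul_eq_mul, smul_eq_mul] at h3
  rw [← mul_le_mul_iff_right₀ hpi, mul_add, ← mul_assoc, mul_inv_cancel₀ hpi.ne', one_mul]
  exact h3

/-! ### Functions of bounded variation -/

theorem exists_eVariationOn_le {g : ℝ → ℝ} {M : ℝ≥0∞} (hM : M < ⊤) (hg : tvNorm g ≤ M) :
    ∃ v : ℝ → ℝ, v =ᵐ[circ] g ∧ eVariationOn v (Icc 0 (2 * Real.pi)) ≤ M + 1 := by
  have h1 := (self_le_add_left _ _).trans hg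
  have h2 := h1.trans_lt (ENNReal.lt_add_right hM.ne one_ne_zero)
  simp only [iInf_lt_iff] at h2
  obtain ⟨v, hv, -, hlt⟩ := h2
  exact ⟨v, hv, hlt.le⟩

/-- Functions in a ball of `TV(S)` are uniformly bounded. -/
theorem ae_abs_le_of_tvNorm_le {g : ℝ → ℝ} {M : ℝ≥0∞} (hM : M < ⊤) (hg : tvNorm g ≤ M) :
    ∀ᵐ s ∂circ, |g s| ≤ (M + (M + 1) * ENNReal.ofReal (2 * Real.pi)).toReal := by
  obtain ⟨v, hv, hV⟩ := exists_eVariationOn_le hM hg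
  have hfin : M + (M + 1) * ENNReal.ofReal (2 * Real.pi) ≠ ⊤ :=
    ENNReal.add_ne_top.2 ⟨hM.ne, ENNReal.mul_ne_top (ENNReal.add_ne_top.2 ⟨hM.ne, by simp⟩)
      ENNReal.ofReal_ne_top⟩
  have h1 : ∫⁻ y, ‖v y‖ₑ ∂circ ≤ M := by
    rw [← eLpNorm_one_eq_lintegral_enorm, eLpNorm_congr_ae hv]
    exact (self_le_add_right _ _).trans hg
  filter_upwards [hv, ae_circ_mem] with x hx hxm
  have h2 : ∫⁻ _ : ℝ, ‖v x‖ₑ ∂circ ≤ ∫⁻ y, (‖v y‖ₑ + (M + 1)) ∂circ := by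
    refine lintegral_mono_ae ?_
    filter_upwards [ae_circ_mem] with y hy
    have h3 := eVariationOn.edist_le v (Ioc_subset_Icc_self hxm) (Ioc_subset_Icc_self hy)
    calc ‖v x‖ₑ = ‖v y + (v x - v y)‖ₑ := by congr 1; ring
      _ ≤ ‖v y‖ₑ + ‖v x - v y‖ₑ := enorm_add_le _ _
      _ ≤ ‖v y‖ₑ + (M + 1) := by
        gcongr
        rw [← edist_eq_enorm_sub]
        exact h3.trans hV
  rw [lintegral_add_right _ measurable_const, lintegral_const, lintegral_const, circ_univ] at h2
  have h4 : ‖v x‖ₑ ≤ M + (M + 1) * ENNReal.ofReal (2 * Real.pi) := by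
    have h5 : (1 : ℝ≥0∞) ≤ ENNReal.ofReal (2 * Real.pi) := by
      rw [ENNReal.one_le_ofReal]; linarith [Real.pi_gt_three]
    calc ‖v x‖ₑ = ‖v x‖ₑ * 1 := (mul_one _).symm
      _ ≤ ‖v x‖ₑ * ENNReal.ofReal (2 * Real.pi) := by gcongr
      _ ≤ _ := h2.trans (by gcongr)
  rw [← hx, ← Real.norm_eq_abs, ← toReal_enorm]
  exact ENNReal.toReal_mono hfin h4

/-- Functions in a ball of `TV(S)` have a common Lipschitz modulus of continuity in `L_1(S)`. -/
theorem transMod_le_of_tvNorm_le {g : ℝ → ℝ} {M : ℝ≥0∞} (hM : M < ⊤) (hg : tvNorm g ≤ M)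
    {a : ℝ} (ha : |a| ≤ 2 * Real.pi) :
    transMod g a ≤ 2 * (M + 1) * ENNReal.ofReal |a| := by
  obtain ⟨v, hv, hV⟩ := exists_eVariationOn_le hM hg
  rw [← transMod_abs, ← transMod_congr_ae hv]
  have hτ := abs_nonneg a
  generalize |a| = τ at ha hτ ⊢
  have hfin : M + 1 ≠ ⊤ := ENNReal.add_ne_top.2 ⟨hM.ne, by simp⟩
  set A : ℝ := (M + 1).toReal with hA
  have hA0 : 0 ≤ A := ENNReal.toReal_nonneg
  have hAe : ENNReal.ofReal A = M + 1 := ENNReal.ofReal_toReal hfin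
  set R : ℝ → ℝ := fun x => (eVariationOn v (Icc 0 x)).toReal with hR
  have hVle : ∀ x ≤ 2 * Real.pi, eVariationOn v (Icc 0 x) ≤ M + 1 := fun x hx =>
    (eVariationOn.mono v (Icc_subset_Icc_right hx)).trans hV
  have hVne : ∀ x ≤ 2 * Real.pi, eVariationOn v (Icc 0 x) ≠ ⊤ := fun x hx =>
    ((hVle x hx).trans_lt hfin.lt_top).ne
  have hR0 : ∀ x, 0 ≤ R x := fun x => ENNReal.toReal_nonneg
  have hRA : ∀ x ≤ 2 * Real.pi, R x ≤ A := fun x hx => ENNReal.toReal_mono hfin (hVle x hx)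
  have hmono : MonotoneOn R (Iic (2 * Real.pi)) := fun x hx y hy hxy =>
    ENNReal.toReal_mono (hVne y hy) (eVariationOn.mono v (Icc_subset_Icc_right hxy))
  have hRi : ∀ x y, x ≤ 2 * Real.pi → y ≤ 2 * Real.pi → IntervalIntegrable R volume x y :=
    fun x y hx hy => (hmono.mono fun z hz => hz.2.trans (max_le hx hy)).intervalIntegrable
  have hsplit : Ioc 0 (2 * Real.pi) = Ioc 0 (2 * Real.pi - τ) ∪ Ioc (2 * Real.pi - τ) (2 * Real.pi) :=
    (Ioc_union_Ioc_eq_Ioc (by linarith) (by linarith)).symm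
  have h1 : ∫⁻ x in Ioc 0 (2 * Real.pi - τ), ‖perExt v (x + τ) - perExt v x‖ₑ
      ≤ (M + 1) * ENNReal.ofReal τ := by
    have hi1 : IntervalIntegrable (fun x => R (x + τ)) volume 0 (2 * Real.pi - τ) := by
      have := (hRi τ (2 * Real.pi) ha le_rfl).comp_add_right τ
      simpa using this
    have hi2 : IntervalIntegrable R volume 0 (2 * Real.pi - τ) :=
      hRi _ _ Real.two_pi_pos.le (by linarith)
    calc ∫⁻ x in Ioc 0 (2 * Real.pi - τ), ‖perExt v (x + τ) - perExt v x‖ₑ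
        ≤ ∫⁻ x in Ioc 0 (2 * Real.pi - τ), ENNReal.ofReal (R (x + τ) - R x) := by
          refine setLIntegral_mono' measurableSet_Ioc fun x hx => ?_
          rw [perExt_of_mem v ⟨by linarith [hx.1], by linarith [hx.2]⟩,
            perExt_of_mem v ⟨hx.1, by linarith [hx.2]⟩]
          have hadd := eVariationOn.Icc_add_Icc v (s := univ) hx.1.le
            (show x ≤ x + τ by linarith) (mem_univ x)
          simp only [univ_inter] at hadd
          have h2 : ‖v (x + τ) - v x‖ₑ ≤ eVariationOn v (Icc x (x + τ)) := by
            rw [← edist_eq_enorm_sub]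
            exact eVariationOn.edist_le v ⟨by linarith, le_rfl⟩ ⟨le_rfl, by linarith⟩
          refine h2.trans ?_
          have h3 : eVariationOn v (Icc x (x + τ)) ≠ ⊤ := fun h => by
            rw [h, add_top] at hadd
            exact hVne (x + τ) (by linarith [hx.2]) hadd.symm
          rw [hR]
          simp only
          rw [← hadd, ENNReal.toReal_add (hVne x (by linarith [hx.2])) h3, add_sub_cancel_left,
            ENNReal.ofReal_toReal h3]
      _ = ENNReal.ofReal (∫ x in Ioc 0 (2 * Real.pi - τ), (R (x + τ) - R x)) := by
          rw [ofReal_integral_eq_lintegral_ofReal]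
          · exact (intervalIntegrable_iff_integrableOn_Ioc_of_le (by linarith)).1 (hi1.sub hi2)
          · filter_upwards [ae_restrict_mem measurableSet_Ioc] with x hx
            exact sub_nonneg.2 (hmono (show x ≤ 2 * Real.pi by linarith [hx.2])
              (show x + τ ≤ 2 * Real.pi by linarith [hx.2]) (by linarith))
      _ ≤ ENNReal.ofReal (A * τ) := by
          refine ENNReal.ofReal_le_ofReal ?_
          rw [← intervalIntegral.integral_of_le (by linarith), intervalIntegral.integral_sub hi1 hi2,
            intervalIntegral.integral_comp_add_right, zero_add, sub_add_cancel]
          have e1 := intervalIntegral.integral_add_adjacent_intervals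
            (hRi 0 τ Real.two_pi_pos.le ha) (hRi τ (2 * Real.pi) ha le_rfl)
          have e2 := intervalIntegral.integral_add_adjacent_intervals hi2
            (hRi (2 * Real.pi - τ) (2 * Real.pi) (by linarith) le_rfl)
          have h0 : 0 ≤ ∫ x in 0..τ, R x := intervalIntegral.integral_nonneg hτ fun x _ => hR0 x
          have h3 : ∫ x in (2 * Real.pi - τ)..(2 * Real.pi), R x ≤ A * τ := by
            have := intervalIntegral.integral_mono_on (show 2 * Real.pi - τ ≤ 2 * Real.pi by linarith)
              (hRi (2 * Real.pi - τ) (2 * Real.pi) (by linarith) le_rfl)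
              (intervalIntegrable_const (c := A)) fun x hx => hRA x hx.2
            rw [intervalIntegral.integral_const, sub_sub_cancel, smul_eq_mul] at this
            linarith
          linarith
      _ = (M + 1) * ENNReal.ofReal τ := by rw [ENNReal.ofReal_mul hA0, hAe]
  have h2 : ∫⁻ x in Ioc (2 * Real.pi - τ) (2 * Real.pi), ‖perExt v (x + τ) - perExt v x‖ₑ
      ≤ (M + 1) * ENNReal.ofReal τ := by
    calc ∫⁻ x in Ioc (2 * Real.pi - τ) (2 * Real.pi), ‖perExt v (x + τ) - perExt v x‖ₑ
        ≤ ∫⁻ _ in Ioc (2 * Real.pi - τ) (2 * Real.pi), (M + 1) := by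
          refine setLIntegral_mono' measurableSet_Ioc fun x hx => ?_
          rw [perExt_of_mem v (x := x) ⟨by linarith [hx.1], hx.2⟩,
            ← (perExt_periodic v).sub_eq, perExt_of_mem v ⟨by linarith [hx.1], by linarith [hx.2]⟩,
            ← edist_eq_enorm_sub]
          have m1 : x + τ - 2 * Real.pi ∈ Icc 0 (2 * Real.pi) :=
            ⟨by linarith [hx.1], by linarith [hx.2]⟩
          have m2 : x ∈ Icc 0 (2 * Real.pi) := ⟨by linarith [hx.1], hx.2⟩
          exact (eVariationOn.edist_le v m1 m2).trans hV
      _ = (M + 1) * ENNReal.ofReal τ := by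
          rw [setLIntegral_const, Real.volume_Ioc, sub_sub_cancel]
  calc transMod v τ ≤ (M + 1) * ENNReal.ofReal τ + (M + 1) * ENNReal.ofReal τ := by
        rw [transMod, circ, hsplit]
        exact (lintegral_union_le _ _ _).trans (add_le_add h1 h2)
    _ = 2 * (M + 1) * ENNReal.ofReal τ := by ring

/-! ### The implicit step contracts `L_1` distances between translates -/

theorem subdiff_monotone {f : ℝ → ℝ} {x y a b : ℝ} (ha : a ∈ subdiff f x) (hb : b ∈ subdiff f y) :
    0 ≤ (a - b) * (x - y) := by
  have h1 := ha y
  have h2 := hb x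
  nlinarith

theorem mem_subdiff_J_add {x w : ℝ} :
    w + 2 * Real.pi ∈ subdiff J (x + 2 * Real.pi) ↔ w ∈ subdiff J x := by
  constructor
  · intro h y
    have := h (y + 2 * Real.pi)
    rw [J_add_two_pi, J_add_two_pi] at this
    nlinarith
  · intro h y
    have := h (y - 2 * Real.pi)
    have e := J_add_two_pi (y - 2 * Real.pi)
    rw [sub_add_cancel] at e
    rw [J_add_two_pi, e]
    nlinarith

theorem countable_zero_hasDerivAt_ne_zero (f : ℝ → ℝ) :
    {x | f x = 0 ∧ ∃ d, d ≠ 0 ∧ HasDerivAt f d x}.Countable := by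
  refine (countable_setOfPred_isolated_right_within (s := {x | f x = 0})).mono ?_
  rintro x ⟨hx, d, hd, hf⟩
  refine ⟨hx, ?_⟩
  rw [← empty_mem_iff_bot, mem_nhdsWithin]
  have h := hf.eventually_ne (c := 0) hd
  rw [eventually_nhdsWithin_iff, eventually_nhds_iff] at h
  obtain ⟨U, hU, hUo, hxU⟩ := h
  refine ⟨U, hUo, hxU, ?_⟩
  rintro z ⟨hz, hz0, hzx⟩
  exact hU z hz (ne_of_gt hzx) hz0

/-- On the zero set of `W`, the second derivative of `W` vanishes almost everywhere. -/
theorem ae_deriv_deriv_eq_zero {W X : ℝ → ℝ} (hW : ∀ s, HasDerivAt W (X s) s) :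
    ∀ᵐ s, W s = 0 → ∀ d, HasDerivAt X d s → d = 0 := by
  have h1 := (countable_zero_hasDerivAt_ne_zero W).ae_notMem volume
  have h2 := (countable_zero_hasDerivAt_ne_zero X).ae_notMem volume
  filter_upwards [h1, h2] with s hs1 hs2 h0 d hd
  by_contra hne
  refine hs2 ⟨?_, d, hne, hd⟩
  by_contra hX
  exact hs1 ⟨h0, X s, hX, hW s⟩

theorem tendsto_arctan_mul (x : ℝ) :
    Tendsto (fun n : ℕ => Real.arctan (n * x)) atTop (𝓝 (Real.pi / 2 * Real.sign x)) := by
  rcases lt_trichotomy x 0 with h | h | h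
  · rw [Real.sign_of_neg h, mul_neg_one]
    exact (tendsto_nhdsWithin_iff.1 Real.tendsto_arctan_atBot).1.comp
      (tendsto_natCast_atTop_atTop.atTop_mul_const_of_neg h)
  · simp [h]
  · rw [Real.sign_of_pos h, mul_one]
    exact (tendsto_nhdsWithin_iff.1 Real.tendsto_arctan_atTop).1.comp
      (tendsto_natCast_atTop_atTop.atTop_mul_const h)

/-- `∫ sign(W) W'' ≤ 0` for periodic `W`, the limit of `∫ φ(W) W'' = - ∫ φ'(W) W'² ≤ 0`. -/
theorem integral_sign_mul_deriv_nonpos {W X : ℝ → ℝ} (hW : ∀ s, HasDerivAt W (X s) s)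
    (hX : AbsolutelyContinuousOnInterval X 0 (2 * Real.pi)) (hXc : Continuous X)
    (hW0 : W (2 * Real.pi) = W 0) (hX0 : X (2 * Real.pi) = X 0) :
    ∫ s, Real.sign (W s) * deriv X s ∂circ ≤ 0 := by
  have hWc : Continuous W := continuous_iff_continuousAt.2 fun s => (hW s).continuousAt
  have hn : ∀ n : ℕ, ∫ s, Real.arctan (n * W s) * deriv X s ∂circ ≤ 0 := by
    intro n
    have hd : ∀ s, HasDerivAt (fun s => Real.arctan (n * W s))
        (1 / (1 + (n * W s) ^ 2) * (n * X s)) s := fun s => ((hW s).const_mul (n : ℝ)).arctan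
    have hde : deriv (fun s => Real.arctan (n * W s)) =
        fun s => 1 / (1 + (n * W s) ^ 2) * (n * X s) := funext fun s => (hd s).deriv
    have hC1 : ContDiff ℝ 1 fun s => Real.arctan (n * W s) := by
      refine contDiff_one_iff_deriv.2 ⟨fun s => (hd s).differentiableAt, ?_⟩
      rw [hde]
      refine Continuous.mul (continuous_const.div (by fun_prop) fun s => ?_) (by fun_prop)
      positivity
    have hAC : AbsolutelyContinuousOnInterval (fun s => Real.arctan (n * W s)) 0 (2 * Real.pi) :=
      hC1.contDiffOn.absolutelyContinuousOnInterval
    rw [integral_circ, hAC.integral_mul_deriv_eq_deriv_mul hX, hde, hW0, hX0, sub_self, zero_sub,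
      neg_nonpos]
    refine intervalIntegral.integral_nonneg Real.two_pi_pos.le fun s _ => ?_
    have : 1 / (1 + (n * W s) ^ 2) * (n * X s) * X s = 1 / (1 + (n * W s) ^ 2) * n * X s ^ 2 := by
      ring
    rw [this]
    positivity
  have hXi : Integrable (deriv X) circ := integrable_circ_iff.2 hX.intervalIntegrable_deriv
  have hlim : Tendsto (fun n : ℕ => ∫ s, Real.arctan (n * W s) * deriv X s ∂circ) atTop
      (𝓝 (∫ s, Real.pi / 2 * Real.sign (W s) * deriv X s ∂circ)) := by
    refine tendsto_integral_of_dominated_convergence (fun s => Real.pi / 2 * |deriv X s|) ?_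
      (hXi.abs.const_mul _) ?_ ?_
    · intro n
      exact (Real.continuous_arctan.comp
        (continuous_const.mul hWc)).aestronglyMeasurable.mul hXi.1
    · intro n
      refine Eventually.of_forall fun s => ?_
      rw [norm_mul, Real.norm_eq_abs, Real.norm_eq_abs]
      refine mul_le_mul_of_nonneg_right ?_ (abs_nonneg _)
      exact abs_le.2 ⟨(Real.neg_pi_div_two_lt_arctan _).le, (Real.arctan_lt_pi_div_two _).le⟩
    · exact Eventually.of_forall fun s => (tendsto_arctan_mul (W s)).mul_const _
  have h := le_of_tendsto' hlim hn
  simp only [mul_assoc] at h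
  rw [integral_const_mul] at h
  have hpi : 0 < Real.pi / 2 := by positivity
  by_contra hc
  exact absurd h (not_le.2 (mul_pos hpi (not_le.1 hc)))

/-- The integral `∫_S |w(x + a) - w(x)| dx` for the quasi-periodic function `w(x) = p(x) + x`. -/
noncomputable def angleMod (p : ℝ → ℝ) (a : ℝ) : ℝ≥0∞ :=
  ∫⁻ x, ‖perExt p (x + a) - perExt p x + a‖ₑ ∂circ

theorem transMod_le_angleMod (p : ℝ → ℝ) (a : ℝ) :
    transMod p a ≤ angleMod p a + ENNReal.ofReal |a| * ENNReal.ofReal (2 * Real.pi) := by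
  have h : transMod p a ≤ ∫⁻ x, (‖perExt p (x + a) - perExt p x + a‖ₑ + ‖a‖ₑ) ∂circ :=
    lintegral_mono fun x => by
      calc ‖perExt p (x + a) - perExt p x‖ₑ = ‖(perExt p (x + a) - perExt p x + a) - a‖ₑ := by
            rw [add_sub_cancel_right]
        _ ≤ _ := enorm_sub_le
  rwa [lintegral_add_right _ measurable_const, lintegral_const, circ_univ,
    Real.enorm_eq_ofReal_abs] at h

theorem angleMod_le_transMod (p : ℝ → ℝ) (a : ℝ) :
    angleMod p a ≤ transMod p a + ENNReal.ofReal |a| * ENNReal.ofReal (2 * Real.pi) := by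
  have h : angleMod p a ≤ ∫⁻ x, (‖perExt p (x + a) - perExt p x‖ₑ + ‖a‖ₑ) ∂circ :=
    lintegral_mono fun x => enorm_add_le _ _
  rwa [lintegral_add_right _ measurable_const, lintegral_const, circ_univ,
    Real.enorm_eq_ofReal_abs] at h

/-- One implicit step does not increase the `L_1` distance between the angle `u_s + s` and its
translates: the step is an implicit Euler step of a filtration equation for the angle, and such
steps contract `L_1` distances. -/
theorem angleMod_le_of_step {h : ℝ} (hh : 0 < h) {u v p q ω : ℝ → ℝ} (hu : HasWeakDeriv u p)
    (hv : HasWeakDeriv v q) (hω : AbsolutelyContinuousOnInterval ω 0 (2 * Real.pi))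
    (hω2 : ω (2 * Real.pi) = ω 0 + 2 * Real.pi)
    (hJ : ∀ᵐ s ∂circ, ω s ∈ subdiff J (p s + s)) (hE : ∀ᵐ s ∂circ, (u s - v s) / h = deriv ω s)
    (a : ℝ) : angleMod p a ≤ angleMod q a := by
  have hpi := Real.two_pi_pos
  obtain ⟨U, hU, hUu⟩ := hu.exists_primitive
  obtain ⟨V, hV, hVv⟩ := hv.exists_primitive
  have hpi1 := perExt_intervalIntegrable hu.2.1
  have hqi1 := perExt_intervalIntegrable hv.2.1
  set Y : ℝ → ℝ := fun s => (U s - V s) / h with hY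
  have hYc : Continuous Y := (hU.continuous.sub hV.continuous).div_const h
  have hYp : Function.Periodic Y (2 * Real.pi) := fun s => by
    simp only [hY, hU.periodic s, hV.periodic s]
  -- `ω'` is the `C¹` quasi-periodic extension of `ω`
  set ω' : ℝ → ℝ := fun s => ω 0 + ∫ r in 0..s, Y r with hω'
  have hω'd : ∀ s, HasDerivAt ω' (Y s) s := fun s =>
    (hYc.integral_hasStrictDerivAt 0 s).hasDerivAt.const_add _
  have hEq : ∀ s ∈ Icc 0 (2 * Real.pi), ω' s = ω s := by
    intro s hs
    have h1 := (hω.mono (c := 0) (d := s) (by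
      rw [uIcc_of_le hs.1, uIcc_of_le hpi.le]; exact Icc_subset_Icc_right hs.2)).integral_deriv_eq_sub
    have h2 : ∫ r in 0..s, Y r = ∫ r in 0..s, deriv ω r := by
      refine intervalIntegral.integral_congr_ae ?_
      have h3 : ∀ᵐ r ∂circ, Y r = deriv ω r := by
        filter_upwards [hE, hUu, hVv] with r e1 e2 e3
        rw [← e1, hY, ← e2, ← e3]
      rw [ae_circ_iff] at h3
      filter_upwards [h3] with r hr hrs
      rw [uIoc_of_le hs.1] at hrs
      exact hr ⟨hrs.1, hrs.2.trans hs.2⟩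
    rw [hω']; simp only; rw [h2, h1]; ring
  have hint0 : ∫ r in 0..2 * Real.pi, Y r = 2 * Real.pi := by
    have := hEq (2 * Real.pi) ⟨hpi.le, le_rfl⟩
    simp only [hω'] at this
    linarith
  have hω'p : ∀ s, ω' (s + 2 * Real.pi) = ω' s + 2 * Real.pi := by
    intro s
    have e1 := hYp.intervalIntegral_add_eq s 0
    rw [zero_add, hint0] at e1
    have e := intervalIntegral.integral_add_adjacent_intervals
      (hYc.intervalIntegrable (μ := volume) 0 s)
      (hYc.intervalIntegrable (μ := volume) s (s + 2 * Real.pi))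
    simp only [hω']
    rw [← e, e1]; ring
  have hJ' : ∀ᵐ s, ω' s ∈ subdiff J (perExt p s + s) := by
    refine ae_of_ae_circ (P := fun s => ω' s ∈ subdiff J (perExt p s + s)) (fun s => ?_) ?_
    · rw [hω'p, perExt_periodic p, ← add_assoc, mem_subdiff_J_add]
    · filter_upwards [hJ, perExt_ae_eq p, ae_circ_mem] with s h1 h2 h3
      rw [h2, hEq s (Ioc_subset_Icc_self h3)]
      exact h1
  set W : ℝ → ℝ := fun s => ω' (s + a) - ω' s with hW
  set X : ℝ → ℝ := fun s => Y (s + a) - Y s with hX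
  have hWX : ∀ s, HasDerivAt W (X s) s := fun s =>
    ((hω'd (s + a)).comp_add_const s a).sub (hω'd s)
  have hXc : Continuous X := (hYc.comp (continuous_id.add continuous_const)).sub hYc
  set x₁ : ℝ → ℝ := fun s => perExt p (s + a) - perExt p s + a with hx₁
  set x₂ : ℝ → ℝ := fun s => perExt q (s + a) - perExt q s + a with hx₂
  have hYd : ∀ᵐ s, HasDerivAt Y ((perExt p s - perExt q s) / h) s := by
    filter_upwards [hU.ae_hasDerivAt, hV.ae_hasDerivAt] with s h1 h2
    exact (h1.sub h2).div_const h
  have hXd : ∀ᵐ s, HasDerivAt X ((x₁ s - x₂ s) / h) s := by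
    filter_upwards [hYd, ae_shift hYd a] with s h1 h2
    have := (h2.comp_add_const s a).sub h1
    convert! this using 1
    simp only [hx₁, hx₂]; ring
  have hYAC : ∀ b c, AbsolutelyContinuousOnInterval Y b c := by
    intro b c
    have := ((hU.absCont b c).sub (hV.absCont b c)).const_mul h⁻¹
    convert! this using 1
    funext s; simp only [hY]; rw [div_eq_inv_mul]; rfl
  have hYP : IsPeriodicPrimitive Y fun s => (perExt p s - perExt q s) / h := by
    refine ⟨fun s => ?_, fun b c => ((hpi1 b c).sub (hqi1 b c)).div_const h, hYp, fun b c => ?_⟩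
    · simp only [perExt_periodic p s, perExt_periodic q s]
    · rw [intervalIntegral.integral_div, intervalIntegral.integral_sub (hpi1 b c) (hqi1 b c),
        ← hU.sub_eq, ← hV.sub_eq]
      simp only [hY]; ring
  have hXAC : AbsolutelyContinuousOnInterval X 0 (2 * Real.pi) := by
    have h1 : ∀ b c, IntervalIntegrable (fun s => (perExt p (s + a) - perExt q (s + a)) / h)
        volume b c := fun b c => by
      have := (hYP.integrable (b + a) (c + a)).comp_add_right a
      simpa using this
    have h2 : ∀ b c, ∫ s in b..c, (perExt p (s + a) - perExt q (s + a)) / h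
        = Y (c + a) - Y (b + a) := fun b c => by
      rw [hYP.sub_eq]
      exact intervalIntegral.integral_comp_add_right
        (fun s => (perExt p s - perExt q s) / h) a
    have h3 : IsPeriodicPrimitive (fun s => Y (s + a))
        fun s => (perExt p (s + a) - perExt q (s + a)) / h := by
      refine ⟨fun s => ?_, h1, fun s => ?_, fun b c => (h2 b c).symm⟩
      · have e : s + 2 * Real.pi + a = (s + a) + 2 * Real.pi := by ring
        simp only [e, perExt_periodic p (s + a), perExt_periodic q (s + a)]
      · have e : s + 2 * Real.pi + a = (s + a) + 2 * Real.pi := by ring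
        simp only [e, hYp (s + a)]
    exact (h3.absCont _ _).sub (hYAC _ _)
  have hsign := integral_sign_mul_deriv_nonpos hWX hXAC hXc
    (by
      have e1 := hω'p a
      have e2 := hω'p 0
      rw [zero_add] at e2
      simp only [hW]
      rw [add_comm (2 * Real.pi) a, e1, e2, zero_add]; ring)
    (by
      have e1 := hYp a
      have e2 := hYp 0
      rw [zero_add] at e2
      simp only [hX]
      rw [add_comm (2 * Real.pi) a, e1, e2, zero_add])
  -- monotonicity of `∂J`, and `W'' = 0` almost everywhere on `{W = 0}`
  have hpt : ∀ᵐ s, |x₁ s| ≤ |x₂ s| + h * (Real.sign (W s) * deriv X s) := by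
    filter_upwards [hJ', ae_shift hJ' a, hXd, ae_deriv_deriv_eq_zero hWX] with s h1 h2 h3 h4
    have hm := subdiff_monotone h2 h1
    have e : perExt p (s + a) + (s + a) - (perExt p s + s) = x₁ s := by simp only [hx₁]; ring
    rw [e] at hm
    rw [h3.deriv]
    rcases lt_trichotomy (W s) 0 with hw | hw | hw
    · rw [Real.sign_of_neg hw]
      have hx : x₁ s ≤ 0 := by
        by_contra hc
        have := mul_neg_of_neg_of_pos hw (not_le.1 hc)
        linarith
      have e2 : h * (-1 * ((x₁ s - x₂ s) / h)) = x₂ s - x₁ s := by field_simp; ring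
      rw [abs_of_nonpos hx, e2]
      linarith [neg_abs_le (x₂ s)]
    · have := h4 hw _ h3
      have e2 : x₁ s = x₂ s := by
        rw [div_eq_zero_iff] at this
        rcases this with h | h
        · linarith
        · exact absurd h hh.ne'
      rw [this, mul_zero, mul_zero, add_zero, e2]
    · rw [Real.sign_of_pos hw]
      have hx : 0 ≤ x₁ s := by
        by_contra hc
        have := mul_neg_of_pos_of_neg hw (not_le.1 hc)
        linarith
      have e2 : h * (1 * ((x₁ s - x₂ s) / h)) = x₁ s - x₂ s := by field_simp
      rw [abs_of_nonneg hx, e2]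
      linarith [le_abs_self (x₂ s)]
  have hxi : ∀ {r : ℝ → ℝ}, (∀ b c, IntervalIntegrable (perExt r) volume b c) →
      Integrable (fun s => perExt r (s + a) - perExt r s + a) circ := by
    intro r hr
    refine integrable_circ_iff.2 (IntervalIntegrable.add (IntervalIntegrable.sub ?_ (hr _ _))
      intervalIntegrable_const)
    have := (hr (0 + a) (2 * Real.pi + a)).comp_add_right a
    simpa using this
  have hi1 : Integrable x₁ circ := hxi hpi1
  have hi2 : Integrable x₂ circ := hxi hqi1
  have hWm : Measurable fun s => Real.sign (W s) := by
    have hWc : Continuous W := continuous_iff_continuousAt.2 fun s => (hWX s).continuousAt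
    have hsm : Measurable Real.sign := by
      unfold Real.sign
      exact Measurable.ite measurableSet_Iio measurable_const
        (Measurable.ite measurableSet_Ioi measurable_const measurable_const)
    exact hsm.comp hWc.measurable
  have hXi : Integrable (deriv X) circ := integrable_circ_iff.2 hXAC.intervalIntegrable_deriv
  have hi3 : Integrable (fun s => Real.sign (W s) * deriv X s) circ := by
    refine hXi.bdd_mul (c := 1) hWm.aestronglyMeasurable (Eventually.of_forall fun s => ?_)
    rcases Real.sign_apply_eq (W s) with h | h | h <;> simp [h]
  have hle : ∫ s, |x₁ s| ∂circ ≤ ∫ s, |x₂ s| ∂circ := by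
    have := integral_mono_ae hi1.abs (hi2.abs.add (hi3.const_mul h)) (ae_circ_of_ae hpt)
    have e : ∫ s, ((fun s => |x₂ s|) + fun s => h * (Real.sign (W s) * deriv X s)) s ∂circ
        = ∫ s, |x₂ s| ∂circ + h * ∫ s, Real.sign (W s) * deriv X s ∂circ := by
      rw [integral_add' hi2.abs (hi3.const_mul h), integral_const_mul]
    rw [e] at this
    have := mul_nonneg hh.le (neg_nonneg.2 hsign)
    linarith
  have e1 := ofReal_integral_norm_eq_lintegral_enorm hi1
  have e2 := ofReal_integral_norm_eq_lintegral_enorm hi2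
  rw [angleMod, angleMod, ← e1, ← e2]
  exact ENNReal.ofReal_le_ofReal hle

/-! ### Interpolation between `L_1` and the `L_1` modulus of continuity -/

theorem aestronglyMeasurable_perExt_add_sub {g : ℝ → ℝ} (hg : Integrable g circ) (s : Set ℝ) :
    AEStronglyMeasurable (fun z : ℝ × ℝ => perExt g (z.1 + z.2) - perExt g z.1)
      (circ.prod (volume.restrict s)) := by
  have h := perExt_aestronglyMeasurable hg
  have h1 : AEStronglyMeasurable (fun z : ℝ × ℝ => perExt g (z.1 + z.2))
      ((volume : Measure ℝ).prod volume) :=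
    h.comp_quasiMeasurePreserving (Measure.quasiMeasurePreserving_snd.comp
      (measurePreserving_prod_add (volume : Measure ℝ) volume).quasiMeasurePreserving)
  have h2 : AEStronglyMeasurable (fun z : ℝ × ℝ => perExt g z.1)
      ((volume : Measure ℝ).prod volume) := h.comp_fst
  rw [circ, Measure.prod_restrict]
  exact (h1.sub h2).restrict

theorem lintegral_lintegral_translate {g : ℝ → ℝ} (hg : Integrable g circ) (s : Set ℝ)
    (φ : ℝ → ℝ≥0∞) (hφ : Measurable φ) :
    ∫⁻ x, (∫⁻ a in s, ‖perExt g (x + a) - perExt g x‖ₑ * φ a) ∂circ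
      = ∫⁻ a in s, transMod g a * φ a := by
  have hm := (aestronglyMeasurable_perExt_add_sub hg s).enorm.mul
    (hφ.comp measurable_snd).aemeasurable
  rw [lintegral_lintegral_swap hm]
  refine lintegral_congr fun a => ?_
  rw [lintegral_mul_const'', transMod]
  exact ((perExt_shift_aestronglyMeasurable hg a).sub
    (perExt_aestronglyMeasurable hg)).restrict.enorm

theorem IsPeriodicPrimitive.add_sub_eq {F p : ℝ → ℝ} (h : IsPeriodicPrimitive F p) (x r : ℝ) :
    F (x + r) - F x = ∫ a in 0..r, p (x + a) := by
  rw [h.sub_eq, intervalIntegral.integral_comp_add_left, add_zero]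

theorem HasWeakDeriv.transMod_le {f g : ℝ → ℝ} (h : HasWeakDeriv f g) (a : ℝ) :
    transMod f a ≤ ENNReal.ofReal |a| * eLpNorm g 1 circ := by
  obtain ⟨F, hF, hFf⟩ := h.exists_primitive
  rw [← transMod_abs]
  have ha := abs_nonneg a
  generalize |a| = r at ha ⊢
  have hFF : ∀ᵐ x, perExt f x = F x := by
    refine ae_of_ae_circ (P := fun x => perExt f x = F x)
      (fun x => by rw [perExt_periodic f x, hF.periodic x]) ?_
    filter_upwards [hFf, perExt_ae_eq f] with x h1 h2
    rw [h1, h2]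
  have h1 : transMod f r ≤ ∫⁻ x, (∫⁻ a in Ioc 0 r, ‖perExt g (x + a)‖ₑ) ∂circ := by
    refine lintegral_mono_ae (ae_circ_of_ae ?_)
    filter_upwards [hFF, ae_shift hFF r] with x hx hxr
    rw [hx, hxr, hF.add_sub_eq, intervalIntegral.integral_of_le ha]
    exact enorm_integral_le_lintegral_enorm _
  refine h1.trans ?_
  have hm : AEStronglyMeasurable (fun z : ℝ × ℝ => perExt g (z.1 + z.2))
      (circ.prod (volume.restrict (Ioc 0 r))) := by
    have e := (aestronglyMeasurable_perExt_add_sub h.2.1 (Ioc 0 r)).add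
      ((perExt_aestronglyMeasurable h.2.1).restrict (s := Ioc 0 (2 * Real.pi))).comp_fst
    refine e.congr (Eventually.of_forall fun z => ?_)
    simp
  rw [lintegral_lintegral_swap hm.enorm]
  have : ∀ a, ∫⁻ x, ‖perExt g (x + a)‖ₑ ∂circ = eLpNorm g 1 circ := fun a => by
    rw [lintegral_circ_shift (enorm_perExt_periodic g) a, lintegral_enorm_perExt]
  simp only [this]
  rw [setLIntegral_const, Real.volume_Ioc, sub_zero, mul_comm]

/-- A function whose derivative has a Lipschitz `L_1` modulus of continuity: the `L_1` norm of the
derivative is controlled by difference quotients. -/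
theorem HasWeakDeriv.eLpNorm_deriv_le {f g : ℝ → ℝ} (h : HasWeakDeriv f g) {C : ℝ≥0∞}
    (hC : ∀ a, |a| ≤ Real.pi → transMod g a ≤ C * ENNReal.ofReal |a|) {r : ℝ} (hr : 0 < r)
    (hrpi : r ≤ Real.pi) :
    eLpNorm g 1 circ ≤ 2 * eLpNorm f 1 circ / ENNReal.ofReal r + C * ENNReal.ofReal r := by
  obtain ⟨F, hF, hFf⟩ := h.exists_primitive
  have hgi := perExt_intervalIntegrable h.2.1
  have hpt : ∀ x, ENNReal.ofReal r * ‖perExt g x‖ₑ ≤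
      ‖F (x + r) - F x‖ₑ + ∫⁻ a in Ioc 0 r, ‖perExt g (x + a) - perExt g x‖ₑ * 1 := by
    intro x
    have hsh : IntervalIntegrable (fun a => perExt g (x + a)) volume 0 r := by
      have := (hgi (x + 0) (x + r)).comp_add_left x
      simpa using this
    have e1 : ∫ a in 0..r, (perExt g (x + a) - perExt g x) = F (x + r) - F x - r * perExt g x := by
      rw [intervalIntegral.integral_sub hsh intervalIntegrable_const, ← hF.add_sub_eq]
      simp
    have e2 : r * perExt g x = (F (x + r) - F x) -
        ∫ a in 0..r, (perExt g (x + a) - perExt g x) := by rw [e1]; ring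
    have e3 : ENNReal.ofReal r * ‖perExt g x‖ₑ = ‖r * perExt g x‖ₑ := by
      rw [enorm_mul, Real.enorm_eq_ofReal hr.le]
    rw [e3, e2]
    refine enorm_sub_le.trans (add_le_add le_rfl ?_)
    rw [intervalIntegral.integral_of_le hr.le]
    simp only [mul_one]
    exact enorm_integral_le_lintegral_enorm _
  have hFp : Function.Periodic (fun x => ‖F x‖ₑ) (2 * Real.pi) := fun x => by
    simp only [hF.periodic x]
  have hFn : ∫⁻ x, ‖F x‖ₑ ∂circ = eLpNorm f 1 circ := by
    rw [← eLpNorm_one_eq_lintegral_enorm, eLpNorm_congr_ae hFf]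
  have hFm : Measurable fun x => ‖F (x + r) - F x‖ₑ := by
    have := hF.continuous
    exact (by fun_prop : Continuous fun x => F (x + r) - F x).measurable.enorm
  have h1 : ENNReal.ofReal r * eLpNorm g 1 circ ≤
      2 * eLpNorm f 1 circ + ENNReal.ofReal r * (C * ENNReal.ofReal r) := by
    calc ENNReal.ofReal r * eLpNorm g 1 circ = ∫⁻ x, ENNReal.ofReal r * ‖perExt g x‖ₑ ∂circ := by
          rw [lintegral_const_mul' _ _ ENNReal.ofReal_ne_top, lintegral_enorm_perExt]
      _ ≤ ∫⁻ x, (‖F (x + r) - F x‖ₑ +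
            ∫⁻ a in Ioc 0 r, ‖perExt g (x + a) - perExt g x‖ₑ * 1) ∂circ :=
          lintegral_mono hpt
      _ = ∫⁻ x, ‖F (x + r) - F x‖ₑ ∂circ + ∫⁻ a in Ioc 0 r, transMod g a * 1 := by
          rw [lintegral_add_left hFm, lintegral_lintegral_translate h.2.1 _ (fun _ => 1)
            measurable_const]
      _ ≤ (∫⁻ x, (‖F (x + r)‖ₑ + ‖F x‖ₑ) ∂circ) + ∫⁻ a in Ioc 0 r, C * ENNReal.ofReal r := by
          refine add_le_add (lintegral_mono fun x => enorm_sub_le) ?_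
          refine setLIntegral_mono' measurableSet_Ioc fun a ha => ?_
          rw [mul_one]
          refine (hC a ?_).trans ?_
          · rw [abs_of_pos ha.1]; exact ha.2.trans hrpi
          · rw [abs_of_pos ha.1]
            gcongr
            exact ha.2
      _ = 2 * eLpNorm f 1 circ + ENNReal.ofReal r * (C * ENNReal.ofReal r) := by
          rw [lintegral_add_right _ hF.continuous.measurable.enorm, lintegral_circ_shift hFp,
            hFn, setLIntegral_const, Real.volume_Ioc, sub_zero, two_mul]
          ring
  have hr0 : ENNReal.ofReal r ≠ 0 := by simpa using hr
  rw [mul_comm, ← ENNReal.le_div_iff_mul_le (Or.inl hr0) (Or.inl ENNReal.ofReal_ne_top)] at h1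
  refine h1.trans (le_of_eq ?_)
  rw [ENNReal.add_div, mul_comm (ENNReal.ofReal r),
    ENNReal.mul_div_cancel_right hr0 ENNReal.ofReal_ne_top]

theorem circDist_add_right {x a : ℝ} (ha : |a| ≤ Real.pi) : circDist x (x + a) = |a| := by
  have h : x - (x + a) = -a := by ring
  rw [circDist, h, ← abs_neg a, AddCircle.norm_coe_eq_abs_iff _ Real.two_pi_pos.ne']
  rw [abs_neg, abs_of_pos Real.two_pi_pos]
  linarith

/-- The Slobodeckij seminorm in terms of the `L_1` modulus of continuity. -/
theorem lintegral_slobodeckij_eq {g : ℝ → ℝ} (hg : Integrable g circ) (θ : ℝ) :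
    ∫⁻ x, ∫⁻ y, ENNReal.ofReal |g x - g y| / ENNReal.ofReal (circDist x y ^ (1 + θ)) ∂circ ∂circ
      = ∫⁻ a in Ioc (-Real.pi) Real.pi,
          transMod g a * (ENNReal.ofReal (|a| ^ (1 + θ)))⁻¹ := by
  have hm : Measurable fun a : ℝ => (ENNReal.ofReal (|a| ^ (1 + θ)))⁻¹ := by fun_prop
  rw [← lintegral_lintegral_translate hg _ _ hm]
  refine lintegral_congr_ae ?_
  filter_upwards [perExt_ae_eq g] with x hx
  set G : ℝ → ℝ≥0∞ := fun y => ENNReal.ofReal |perExt g x - perExt g y| /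
    ENNReal.ofReal (circDist x y ^ (1 + θ)) with hG
  have hGp : Function.Periodic G (2 * Real.pi) := fun y => by
    have : circDist x (y + 2 * Real.pi) = circDist x y := by
      unfold circDist
      rw [show x - (y + 2 * Real.pi) = (x - y) - 2 * Real.pi by ring, AddCircle.coe_sub,
        AddCircle.coe_period, sub_zero]
    simp only [hG, perExt_periodic g y, this]
  have e1 : ∫⁻ y, ENNReal.ofReal |g x - g y| / ENNReal.ofReal (circDist x y ^ (1 + θ)) ∂circ
      = ∫⁻ y, G y ∂circ := by
    refine lintegral_congr_ae ?_
    filter_upwards [perExt_ae_eq g] with y hy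
    simp only [hG, hx, hy]
  rw [e1, ← lintegral_periodic hGp (x - Real.pi)]
  have h := (measurePreserving_add_left volume x).setLIntegral_comp_preimage_emb
    (measurableEmbedding_addLeft x) G (Ioc (x - Real.pi) (x - Real.pi + 2 * Real.pi))
  have h2 : (fun a => x + a) ⁻¹' Ioc (x - Real.pi) (x - Real.pi + 2 * Real.pi)
      = Ioc (-Real.pi) Real.pi := by
    ext a
    simp only [mem_preimage, mem_Ioc]
    constructor <;> rintro ⟨h1, h2⟩ <;> constructor <;> linarith
  rw [h2] at h
  rw [← h]
  refine setLIntegral_congr_fun measurableSet_Ioc fun a ha => ?_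
  simp only [hG]
  rw [circDist_add_right (abs_le.2 ⟨ha.1.le, ha.2⟩), Real.enorm_eq_ofReal_abs, abs_sub_comm,
    div_eq_mul_inv]

theorem lintegral_rpow_abs_lt_top {γ : ℝ} (hγ : γ < 1) :
    ∫⁻ a in Ioc (-Real.pi) Real.pi, ENNReal.ofReal (|a| ^ (-γ)) < ⊤ := by
  have hint : ∀ b, 0 ≤ b → IntervalIntegrable (fun a : ℝ => |a| ^ (-γ)) volume 0 b := by
    intro b hb
    refine (intervalIntegral.intervalIntegrable_rpow' (r := -γ) (by linarith)).congr ?_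
    intro a ha
    rw [uIoc_of_le hb] at ha
    simp only [abs_of_pos ha.1]
  have h1 := hint Real.pi Real.pi_pos.le
  have h2 : IntervalIntegrable (fun a : ℝ => |a| ^ (-γ)) volume (-Real.pi) 0 := by
    rw [IntervalIntegrable.iff_comp_neg]
    simpa using h1.symm
  have h3 := h2.trans h1
  rw [intervalIntegrable_iff_integrableOn_Ioc_of_le (by linarith [Real.pi_pos])] at h3
  have := h3.2
  rw [hasFiniteIntegral_iff_ofReal (Eventually.of_forall fun a => by positivity)] at this
  exact this

theorem slobodeckijNorm_le {θ : ℝ} (hθ1 : θ < 1) {g : ℝ → ℝ} (hg : Integrable g circ)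
    {C : ℝ≥0∞} (hC : ∀ a, |a| ≤ Real.pi → transMod g a ≤ C * ENNReal.ofReal |a|) :
    slobodeckijNorm θ g ≤ eLpNorm g 1 circ +
      C ^ (1 - (1 - θ) / 2) * (2 * eLpNorm g 1 circ) ^ ((1 - θ) / 2) *
        ∫⁻ a in Ioc (-Real.pi) Real.pi, ENNReal.ofReal (|a| ^ (-((1 + θ) / 2))) := by
  unfold slobodeckijNorm
  split_ifs with hθ
  swap
  · simp
  refine add_le_add le_rfl ?_
  set β := (1 - θ) / 2 with hβ
  have hβ0 : 0 < β := by rw [hβ]; linarith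
  have hβ1 : 0 < 1 - β := by rw [hβ]; linarith
  rw [lintegral_slobodeckij_eq hg, ← lintegral_const_mul _ (by fun_prop)]
  refine lintegral_mono_ae ?_
  have hne : ∀ᵐ a ∂(volume.restrict (Ioc (-Real.pi) Real.pi)), a ≠ 0 :=
    ae_restrict_of_ae (by simp [ae_iff, measure_singleton])
  filter_upwards [ae_restrict_mem measurableSet_Ioc, hne] with a ha ha0
  have hapos : 0 < |a| := abs_pos.2 ha0
  have h1 := hC a (abs_le.2 ⟨ha.1.le, ha.2⟩)
  have h2 := transMod_le_two hg a
  have h3 : transMod g a ≤ (C * ENNReal.ofReal |a|) ^ (1 - β) * (2 * eLpNorm g 1 circ) ^ β := by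
    calc transMod g a = transMod g a ^ ((1 - β) + β) := by
          rw [sub_add_cancel, ENNReal.rpow_one]
      _ = transMod g a ^ (1 - β) * transMod g a ^ β :=
          ENNReal.rpow_add_of_nonneg _ _ hβ1.le hβ0.le
      _ ≤ _ := mul_le_mul' (ENNReal.rpow_le_rpow h1 hβ1.le) (ENNReal.rpow_le_rpow h2 hβ0.le)
  calc transMod g a * (ENNReal.ofReal (|a| ^ (1 + θ)))⁻¹
      ≤ (C * ENNReal.ofReal |a|) ^ (1 - β) * (2 * eLpNorm g 1 circ) ^ β *
          (ENNReal.ofReal (|a| ^ (1 + θ)))⁻¹ := by gcongr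
    _ = C ^ (1 - β) * (2 * eLpNorm g 1 circ) ^ β *
          (ENNReal.ofReal |a| ^ (1 - β) * (ENNReal.ofReal (|a| ^ (1 + θ)))⁻¹) := by
        rw [ENNReal.mul_rpow_of_nonneg _ _ hβ1.le]; ring
    _ = C ^ (1 - β) * (2 * eLpNorm g 1 circ) ^ β * ENNReal.ofReal (|a| ^ (-((1 + θ) / 2))) := by
        congr 1
        rw [ENNReal.ofReal_rpow_of_pos hapos, ← ENNReal.ofReal_inv_of_pos (by positivity),
          ← ENNReal.ofReal_mul (by positivity), ← Real.rpow_neg hapos.le,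
          ← Real.rpow_add hapos]
        congr 2
        rw [hβ]; ring

theorem exists_slobodeckijNorm_le {θ : ℝ} (hθ0 : 0 ≤ θ) (hθ1 : θ < 1) {C : ℝ≥0∞} (hC : C < ⊤)
    {δ : ℝ} (hδ : 0 < δ) :
    ∃ A : ℝ, 0 < A ∧ ∀ g : ℝ → ℝ, Integrable g circ →
      (∀ a, |a| ≤ Real.pi → transMod g a ≤ C * ENNReal.ofReal |a|) →
      eLpNorm g 1 circ ≤ ENNReal.ofReal A → slobodeckijNorm θ g ≤ ENNReal.ofReal δ := by
  set β := (1 - θ) / 2 with hβ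
  have hβ0 : 0 < β := by rw [hβ]; linarith
  have hβ1 : 0 < 1 - β := by rw [hβ]; linarith
  set K := ∫⁻ a in Ioc (-Real.pi) Real.pi, ENNReal.ofReal (|a| ^ (-((1 + θ) / 2))) with hK
  have hKt : K < ⊤ := lintegral_rpow_abs_lt_top (by linarith)
  set Φ : ℝ≥0∞ → ℝ≥0∞ := fun A => A + C ^ (1 - β) * (2 * A) ^ β * K with hΦ
  have hCt : C ^ (1 - β) ≠ ⊤ := ENNReal.rpow_ne_top_of_nonneg hβ1.le hC.ne
  have hcont : Continuous Φ := by
    have h1 : Continuous fun A : ℝ≥0∞ => (2 * A) ^ β :=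
      ENNReal.continuous_rpow_const.comp (ENNReal.continuous_const_mul (by simp))
    have h2 : Continuous fun A : ℝ≥0∞ => C ^ (1 - β) * (2 * A) ^ β :=
      (ENNReal.continuous_const_mul hCt).comp h1
    exact continuous_id.add ((ENNReal.continuous_mul_const hKt.ne).comp h2)
  have h0 : Φ 0 = 0 := by simp [hΦ, ENNReal.zero_rpow_of_pos hβ0]
  have hlim : Tendsto (fun A : ℝ => Φ (ENNReal.ofReal A)) (𝓝[>] 0) (𝓝 0) := by
    have h := (hcont.comp ENNReal.continuous_ofReal).tendsto 0
    simp only [Function.comp_apply, ENNReal.ofReal_zero, h0] at h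
    exact h.mono_left nhdsWithin_le_nhds
  have hev := hlim.eventually (ge_mem_nhds (show (0 : ℝ≥0∞) < ENNReal.ofReal δ by simpa using hδ))
  obtain ⟨A, hA, hA0⟩ := (hev.and self_mem_nhdsWithin).exists
  refine ⟨A, hA0, fun g hg hgC hgA => (slobodeckijNorm_le hθ1 hg hgC).trans (le_trans ?_ hA)⟩
  simp only [hΦ]
  gcongr

/-- Interpolation: among functions whose derivatives have a common Lipschitz modulus of continuity
in `L_1(S)`, smallness in `L_1(S)` implies smallness in `W^σ_1(S)` for every `σ < 2`. -/
theorem exists_sobolevNorm_le {σ : ℝ} (hσ0 : 0 ≤ σ) (hσ2 : σ < 2) {C : ℝ≥0∞} (hC : C < ⊤)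
    {δ : ℝ} (hδ : 0 < δ) :
    ∃ A : ℝ, 0 < A ∧ ∀ f g : ℝ → ℝ, HasWeakDeriv f g →
      (∀ a, |a| ≤ Real.pi → transMod g a ≤ C * ENNReal.ofReal |a|) →
      eLpNorm f 1 circ ≤ ENNReal.ofReal A → sobolevNorm σ f ≤ ENNReal.ofReal δ := by
  -- smallness of the derivative in `L_1`
  have hder : ∀ B : ℝ, 0 < B → ∃ A : ℝ, 0 < A ∧ ∀ f g : ℝ → ℝ, HasWeakDeriv f g →
      (∀ a, |a| ≤ Real.pi → transMod g a ≤ C * ENNReal.ofReal |a|) →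
      eLpNorm f 1 circ ≤ ENNReal.ofReal A → eLpNorm g 1 circ ≤ ENNReal.ofReal B := by
    intro B hB
    have hc0 : 0 ≤ C.toReal := ENNReal.toReal_nonneg
    set r : ℝ := min Real.pi (B / (2 * (C.toReal + 1))) with hr
    have hr0 : 0 < r := lt_min Real.pi_pos (by positivity)
    have hCr : C.toReal * r ≤ B / 2 := by
      have h1 : r ≤ B / (2 * (C.toReal + 1)) := min_le_right _ _
      rw [le_div_iff₀ (by positivity)] at h1
      nlinarith
    refine ⟨r * B / 4, by positivity, fun f g hfg hgC hfA => ?_⟩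
    have h := hfg.eLpNorm_deriv_le hgC hr0 (min_le_left _ _)
    have h2 : 2 * eLpNorm f 1 circ / ENNReal.ofReal r ≤ ENNReal.ofReal (B / 2) := by
      refine ENNReal.div_le_of_le_mul ?_
      calc 2 * eLpNorm f 1 circ ≤ 2 * ENNReal.ofReal (r * B / 4) := by gcongr
        _ = ENNReal.ofReal (B / 2) * ENNReal.ofReal r := by
          rw [← ENNReal.ofReal_mul (by positivity), ← ENNReal.ofReal_ofNat 2,
            ← ENNReal.ofReal_mul (by norm_num)]
          congr 1; ring
    have h3 : C * ENNReal.ofReal r ≤ ENNReal.ofReal (B / 2) := by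
      rw [← ENNReal.ofReal_toReal hC.ne, ← ENNReal.ofReal_mul hc0]
      exact ENNReal.ofReal_le_ofReal hCr
    refine h.trans ((add_le_add h2 h3).trans (le_of_eq ?_))
    rw [← ENNReal.ofReal_add (by positivity) (by positivity)]
    congr 1; ring
  rcases lt_or_ge σ 1 with h1 | h1
  · obtain ⟨A₁, hA₁, H₁⟩ := hder 1 one_pos
    obtain ⟨A₂, hA₂, H₂⟩ := exists_slobodeckijNorm_le hσ0 h1 (C := 1) ENNReal.one_lt_top hδ
    refine ⟨min A₁ A₂, lt_min hA₁ hA₂, fun f g hfg hgC hfA => ?_⟩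
    rw [sobolevNorm, if_pos h1]
    refine H₂ f hfg.1 (fun a _ => ?_) (hfA.trans (ENNReal.ofReal_le_ofReal (min_le_right _ _)))
    have := H₁ f g hfg hgC (hfA.trans (ENNReal.ofReal_le_ofReal (min_le_left _ _)))
    rw [ENNReal.ofReal_one] at this
    calc transMod f a ≤ ENNReal.ofReal |a| * eLpNorm g 1 circ := hfg.transMod_le a
      _ ≤ ENNReal.ofReal |a| * 1 := by gcongr
      _ = 1 * ENNReal.ofReal |a| := mul_comm _ _
  · obtain ⟨A₂, hA₂, H₂⟩ := exists_slobodeckijNorm_le (θ := σ - 1) (by linarith) (by linarith) hC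
      (half_pos hδ)
    obtain ⟨A₁, hA₁, H₁⟩ := hder A₂ hA₂
    refine ⟨min A₁ (δ / 2), lt_min hA₁ (half_pos hδ), fun f g hfg hgC hfA => ?_⟩
    rw [sobolevNorm, if_neg (not_lt.2 h1)]
    have h2 := H₂ g hfg.2.1 hgC
      (H₁ f g hfg hgC (hfA.trans (ENNReal.ofReal_le_ofReal (min_le_left _ _))))
    have h3 : ⨅ (g : ℝ → ℝ) (_ : HasWeakDeriv f g), slobodeckijNorm (σ - 1) g
        ≤ ENNReal.ofReal (δ / 2) := (iInf₂_le g hfg).trans h2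
    refine (add_le_add (hfA.trans (ENNReal.ofReal_le_ofReal (min_le_right _ _))) h3).trans
      (le_of_eq ?_)
    rw [← ENNReal.ofReal_add (by positivity) (by positivity), add_halves]

/-! ### The time derivative of a weak solution -/

theorem lp_norm_sq (f : Lp ℝ 2 circ) : ‖f‖ ^ 2 = ∫ s, f s ^ 2 ∂circ := by
  rw [← real_inner_self_eq_norm_sq, L2.inner_def]
  refine integral_congr_ae (Eventually.of_forall fun s => ?_)
  simp [sq]

theorem lp_inner (f g : Lp ℝ 2 circ) : inner ℝ f g = ∫ s, f s * g s ∂circ := by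
  rw [L2.inner_def]
  refine integral_congr_ae (Eventually.of_forall fun s => ?_)
  simp [mul_comm]

theorem lp_integrable (f : Lp ℝ 2 circ) : Integrable f circ :=
  (Lp.memLp f).integrable one_le_two

theorem lp_integrable_sq (f : Lp ℝ 2 circ) : Integrable (fun s => f s ^ 2) circ :=
  (Lp.memLp f).integrable_sq

theorem isTest_cos_pow (n : ℕ) : IsTest fun s => ((1 + Real.cos s) / 2) ^ n := by
  refine ⟨?_, fun s => ?_⟩
  · exact ((contDiff_const.add Real.contDiff_cos).div_const 2).pow n
  · simp only [Real.cos_periodic s]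

theorem tendsto_integral_cos_pow {G : ℝ → ℝ} (hG : Integrable G circ) :
    Tendsto (fun n : ℕ => ∫ s, G s * ((1 + Real.cos s) / 2) ^ n ∂circ) atTop (𝓝 0) := by
  have hb : ∀ s : ℝ, 0 ≤ (1 + Real.cos s) / 2 ∧ (1 + Real.cos s) / 2 ≤ 1 := fun s =>
    ⟨by linarith [Real.neg_one_le_cos s], by linarith [Real.cos_le_one s]⟩
  have : Tendsto (fun n : ℕ => ∫ s, G s * ((1 + Real.cos s) / 2) ^ n ∂circ) atTop
      (𝓝 (∫ _, (0 : ℝ) ∂circ)) := by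
    refine tendsto_integral_of_dominated_convergence (fun s => |G s|) ?_ hG.abs ?_ ?_
    · intro n
      exact hG.1.mul (isTest_cos_pow n).continuous.aestronglyMeasurable
    · intro n
      refine Eventually.of_forall fun s => ?_
      rw [norm_mul, Real.norm_eq_abs, norm_pow, Real.norm_eq_abs, abs_of_nonneg (hb s).1]
      exact mul_le_of_le_one_right (abs_nonneg _) (pow_le_one₀ (hb s).1 (hb s).2)
    · have h2 : ∀ᵐ x : ℝ, x ≠ 2 * Real.pi := by simp [ae_iff, measure_singleton]
      filter_upwards [ae_circ_mem, ae_circ_of_ae h2] with s hs hs2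
      have hlt : (1 + Real.cos s) / 2 < 1 := by
        refine lt_of_le_of_ne (hb s).2 fun h => ?_
        have hc : Real.cos s = 1 := by linarith
        have hs3 : s < 2 * Real.pi := lt_of_le_of_ne hs.2 hs2
        have := (Real.cos_eq_one_iff_of_lt_of_lt (by linarith [hs.1, Real.pi_pos]) hs3).1 hc
        exact hs.1.ne' this
      have := (tendsto_pow_atTop_nhds_zero_of_lt_one (hb s).1 hlt).const_mul (G s)
      rwa [mul_zero] at this
  simpa using this

theorem ae_eq_zero_of_integral_primitive {T : ℝ} (hT : 0 < T) {c : ℝ → ℝ}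
    (hc : IntegrableOn c (Ioc 0 T)) (h : ∀ t ∈ Icc 0 T, ∫ τ in 0..t, c τ = 0) :
    ∀ᵐ τ ∂(volume.restrict (Ioc 0 T)), c τ = 0 := by
  have hi : IntervalIntegrable c volume 0 T :=
    (intervalIntegrable_iff_integrableOn_Ioc_of_le hT.le).2 hc
  rw [ae_restrict_iff' measurableSet_Ioc]
  have h2 : ∀ᵐ x : ℝ, x ≠ T := by simp [ae_iff, measure_singleton]
  filter_upwards [hi.ae_hasDerivAt_integral, h2] with τ h1 h2 hτ
  rw [uIcc_of_le hT.le] at h1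
  have hd := h1 ⟨hτ.1.le, hτ.2⟩ 0 ⟨le_rfl, hT.le⟩
  refine hd.unique ((hasDerivAt_const τ (0 : ℝ)).congr_of_eventuallyEq ?_)
  filter_upwards [Ioo_mem_nhds hτ.1 (lt_of_le_of_ne hτ.2 h2)] with x hx
  exact h x ⟨hx.1.le, hx.2.le⟩

theorem integral_test_eq {ω η : ℝ → ℝ} (hω : AbsolutelyContinuousOnInterval ω 0 (2 * Real.pi))
    (hη : IsTest η) :
    -∫ s, (ω s - s) * deriv η s ∂circ + ∫ s, η s ∂circ =
      ∫ s, deriv ω s * η s ∂circ - (∫ s, deriv ω s ∂circ - 2 * Real.pi) * η 0 := by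
  have hc : Continuous (deriv η) := hη.1.continuous_deriv (by exact_mod_cast le_top)
  have e1 := hω.integral_mul_deriv_eq_deriv_mul (hη.absCont 0 (2 * Real.pi))
  have hid : AbsolutelyContinuousOnInterval (fun s : ℝ => s) 0 (2 * Real.pi) :=
    contDiff_id.contDiffOn.absolutelyContinuousOnInterval
  have e2 := hid.integral_mul_deriv_eq_deriv_mul (hη.absCont 0 (2 * Real.pi))
  have e3 := hω.integral_deriv_eq_sub
  have hi1 : IntervalIntegrable (fun s => ω s * deriv η s) volume 0 (2 * Real.pi) :=
    (hω.continuousOn.mul hc.continuousOn).intervalIntegrable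
  have hi2 : IntervalIntegrable (fun s => s * deriv η s) volume 0 (2 * Real.pi) :=
    (continuous_id.mul hc).intervalIntegrable _ _
  simp only [integral_circ, sub_mul]
  rw [intervalIntegral.integral_sub hi1 hi2, e1, e2, e3, hη.zero_eq]
  simp
  ring

section TimeDerivative

variable {T : ℝ} {Λ : ℝ → Lp ℝ 2 circ} {D : ℝ × ℝ → ℝ}

theorem integrable_strip (hD : Integrable D ((volume.restrict (Ioc 0 T)).prod circ)) {a b : ℝ}
    (ha : 0 ≤ a) (hb : b ≤ T) : Integrable D ((volume.restrict (Ioc a b)).prod circ) := by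
  refine hD.mono_measure ?_
  rw [circ, Measure.prod_restrict, Measure.prod_restrict]
  exact Measure.restrict_mono (prod_mono (Ioc_subset_Ioc ha hb) subset_rfl) le_rfl

theorem ae_intervalIntegrable_slice (hT : 0 ≤ T)
    (hD : Integrable D ((volume.restrict (Ioc 0 T)).prod circ)) :
    ∀ᵐ s ∂circ, IntervalIntegrable (fun τ => D (τ, s)) volume 0 T := by
  filter_upwards [hD.prod_left_ae] with s hs
  exact (intervalIntegrable_iff_integrableOn_Ioc_of_le hT).2 hs

/-- The time derivative of a weak solution is `Ω_s`.  Testing the equation against functions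
concentrating at `s = 0` shows that `Ω - s` is periodic. -/
theorem exists_time_derivative (hT : 0 < T) {Ω : ℝ → ℝ → ℝ}
    (hAC : ∀ᵐ t ∂(volume.restrict (Ioo 0 T)),
      AbsolutelyContinuousOnInterval (Ω t) 0 (2 * Real.pi))
    (hint : Integrable (fun z : ℝ × ℝ => deriv (Ω z.1) z.2) ((volume.restrict (Ioo 0 T)).prod circ))
    (hw : ∀ η, IsTest η → ∀ t ∈ Icc 0 T,
      ∫ s, Λ t s * η s ∂circ - ∫ s, Λ 0 s * η s ∂circ =
        ∫ τ in 0..t, (-∫ s, (Ω τ s - s) * deriv η s ∂circ + ∫ s, η s ∂circ)) :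
    ∃ D : ℝ × ℝ → ℝ, StronglyMeasurable D ∧
      Integrable D ((volume.restrict (Ioc 0 T)).prod circ) ∧
      (∀ᵐ τ ∂(volume.restrict (Ioc 0 T)), (fun s => D (τ, s)) =ᵐ[circ] deriv (Ω τ)) ∧
      (∀ᵐ τ ∂(volume.restrict (Ioc 0 T)), Ω τ (2 * Real.pi) = Ω τ 0 + 2 * Real.pi) ∧
      ∀ t ∈ Icc 0 T, Λ t =ᵐ[circ] fun s => Λ 0 s + ∫ τ in 0..t, D (τ, s) := by
  rw [restrict_Ioo_eq_restrict_Ioc] at hAC hint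
  set D : ℝ × ℝ → ℝ := hint.1.mk _ with hDdef
  have hDs : StronglyMeasurable D := hint.1.stronglyMeasurable_mk
  have hDe := hint.1.ae_eq_mk
  have hD : Integrable D ((volume.restrict (Ioc 0 T)).prod circ) := hint.congr hDe
  have hDΩ : ∀ᵐ τ ∂(volume.restrict (Ioc 0 T)), (fun s => D (τ, s)) =ᵐ[circ] deriv (Ω τ) := by
    filter_upwards [Measure.ae_ae_of_ae_prod hDe] with τ hτ
    filter_upwards [hτ] with s hs using hs.symm
  set c : ℝ → ℝ := fun τ => ∫ s, D (τ, s) ∂circ - 2 * Real.pi with hc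
  have hci : IntegrableOn c (Ioc 0 T) := hD.integral_prod_left.sub (integrable_const _)
  have hrhs : ∀ η, IsTest η → ∀ᵐ τ ∂(volume.restrict (Ioc 0 T)),
      -∫ s, (Ω τ s - s) * deriv η s ∂circ + ∫ s, η s ∂circ =
        ∫ s, D (τ, s) * η s ∂circ - c τ * η 0 := by
    intro η hη
    filter_upwards [hAC, hDΩ] with τ h1 h2
    have e1 : ∫ s, D (τ, s) * η s ∂circ = ∫ s, deriv (Ω τ) s * η s ∂circ :=
      integral_congr_ae (h2.mul (ae_eq_refl η))
    rw [integral_test_eq h1 hη, e1, hc]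
    simp only
    rw [integral_congr_ae h2]
  have hslice := ae_intervalIntegrable_slice hT.le hD
  have hFint : ∀ t ∈ Icc 0 T, Integrable (fun s => ∫ τ in 0..t, D (τ, s)) circ := by
    intro t ht
    simp only [intervalIntegral.integral_of_le ht.1]
    exact (integrable_strip hD le_rfl ht.2).integral_prod_right
  -- the weak form, with the boundary term at `s = 0`
  have hform : ∀ η, IsTest η → ∀ t ∈ Icc 0 T,
      ∫ s, (Λ t s - Λ 0 s - ∫ τ in 0..t, D (τ, s)) * η s ∂circ = -(∫ τ in 0..t, c τ) * η 0 := by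
    intro η hη t ht
    have h1 := hw η hη t ht
    have hηc := hη.continuous.continuousOn (s := Icc 0 (2 * Real.pi))
    have hDη : Integrable (fun z : ℝ × ℝ => D z * η z.2) ((volume.restrict (Ioc 0 t)).prod circ) := by
      obtain ⟨B, hB⟩ := isCompact_Icc.exists_bound_of_continuousOn hηc
      refine (integrable_strip hD le_rfl ht.2).mul_bdd (c := B)
        (hη.continuous.comp continuous_snd).aestronglyMeasurable ?_
      have : ∀ᵐ s ∂circ, ‖η s‖ ≤ B := by
        filter_upwards [ae_circ_mem] with s hs using hB s (Ioc_subset_Icc_self hs)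
      exact Measure.quasiMeasurePreserving_snd.ae this
    have e1 : ∫ τ in 0..t, (-∫ s, (Ω τ s - s) * deriv η s ∂circ + ∫ s, η s ∂circ) =
        ∫ τ in 0..t, (∫ s, D (τ, s) * η s ∂circ - c τ * η 0) := by
      refine intervalIntegral.integral_congr_ae_restrict ?_
      rw [uIoc_of_le ht.1]
      exact ae_mono (Measure.restrict_mono (Ioc_subset_Ioc_right ht.2) le_rfl) (hrhs η hη)
    have hci' : IntervalIntegrable c volume 0 t :=
      (intervalIntegrable_iff_integrableOn_Ioc_of_le ht.1).2
        (hci.mono_set (Ioc_subset_Ioc_right ht.2))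
    have e2 : ∫ τ in 0..t, (∫ s, D (τ, s) * η s ∂circ - c τ * η 0) =
        (∫ τ in 0..t, ∫ s, D (τ, s) * η s ∂circ) - (∫ τ in 0..t, c τ) * η 0 := by
      rw [intervalIntegral.integral_sub _ (hci'.mul_const _), intervalIntegral.integral_mul_const]
      exact (intervalIntegrable_iff_integrableOn_Ioc_of_le ht.1).2 hDη.integral_prod_left
    have e3 : ∫ τ in 0..t, ∫ s, D (τ, s) * η s ∂circ = ∫ s, (∫ τ in 0..t, D (τ, s)) * η s ∂circ := by
      rw [intervalIntegral.integral_of_le ht.1, integral_integral_swap hDη]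
      refine integral_congr_ae (Eventually.of_forall fun s => ?_)
      simp only
      rw [integral_mul_const, intervalIntegral.integral_of_le ht.1]
    rw [e1, e2, e3] at h1
    simp only [sub_mul]
    rw [integral_sub, integral_sub, h1]
    · ring
    · exact integrable_mul_continuous (lp_integrable _) hηc
    · exact integrable_mul_continuous (lp_integrable _) hηc
    · have := integrable_mul_continuous ((lp_integrable (Λ t)).sub (lp_integrable (Λ 0))) hηc
      simpa [sub_mul] using this
    · exact integrable_mul_continuous (hFint t ht) hηc
  have hGint : ∀ t ∈ Icc 0 T,
      Integrable (fun s => Λ t s - Λ 0 s - ∫ τ in 0..t, D (τ, s)) circ := fun t ht =>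
    ((lp_integrable (Λ t)).sub (lp_integrable (Λ 0))).sub (hFint t ht)
  have hczero : ∀ t ∈ Icc 0 T, ∫ τ in 0..t, c τ = 0 := by
    intro t ht
    have h1 := tendsto_integral_cos_pow (hGint t ht)
    have h2 : ∀ n : ℕ, ∫ s, (Λ t s - Λ 0 s - ∫ τ in 0..t, D (τ, s)) *
        ((1 + Real.cos s) / 2) ^ n ∂circ = -(∫ τ in 0..t, c τ) := by
      intro n
      rw [hform _ (isTest_cos_pow n) t ht]
      simp
    simp only [h2] at h1
    have := tendsto_nhds_unique h1 tendsto_const_nhds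
    linarith
  refine ⟨D, hDs, hD, hDΩ, ?_, ?_⟩
  · filter_upwards [ae_eq_zero_of_integral_primitive hT hci hczero, hAC, hDΩ] with τ h1 h2 h3
    have e := h2.integral_deriv_eq_sub
    rw [← integral_circ, ← integral_congr_ae h3] at e
    simp only [hc] at h1
    linarith
  · intro t ht
    have := ae_eq_zero_of_test (hGint t ht) fun η hη => by
      rw [hform η hη t ht, hczero t ht, neg_zero, zero_mul]
    filter_upwards [this] with s hs
    simp only [Pi.zero_apply] at hs
    linarith

/-- A jointly measurable representative of the time primitive. -/
theorem exists_stronglyMeasurable_primitive (hDs : StronglyMeasurable D) (f : Lp ℝ 2 circ) :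
    ∃ u : ℝ × ℝ → ℝ, StronglyMeasurable u ∧
      ∀ t, 0 ≤ t → ∀ s, u (t, s) = f s + ∫ τ in 0..t, D (τ, s) := by
  have hS : MeasurableSet {z : (ℝ × ℝ) × ℝ | 0 < z.2 ∧ z.2 ≤ z.1.1} :=
    (measurableSet_lt measurable_const measurable_snd).inter
      (measurableSet_le measurable_snd (measurable_fst.comp measurable_fst))
  have hD' : StronglyMeasurable fun z : (ℝ × ℝ) × ℝ => D (z.2, z.1.2) :=
    hDs.comp_measurable (measurable_snd.prodMk (measurable_snd.comp measurable_fst))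
  have h1 := (hD'.indicator hS).integral_prod_right' (ν := (volume : Measure ℝ))
  refine ⟨_, ((Lp.stronglyMeasurable f).comp_measurable measurable_snd).add h1, ?_⟩
  intro t ht s
  simp only [Pi.add_apply, Function.comp_apply]
  rw [intervalIntegral.integral_of_le ht, ← integral_indicator measurableSet_Ioc]
  congr 1

theorem integral_abs_sub_le (hD : Integrable D ((volume.restrict (Ioc 0 T)).prod circ))
    (hΛ : ∀ t ∈ Icc 0 T, Λ t =ᵐ[circ] fun s => Λ 0 s + ∫ τ in 0..t, D (τ, s)) {a b : ℝ}
    (ha : 0 ≤ a) (hab : a ≤ b) (hb : b ≤ T) :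
    ∫ s, |(Λ b - Λ a : Lp ℝ 2 circ) s| ∂circ ≤ ∫ τ in a..b, ∫ s, |D (τ, s)| ∂circ := by
  have hT : 0 ≤ T := ha.trans (hab.trans hb)
  have hDs := integrable_strip hD ha hb
  have h1 : ∀ᵐ s ∂circ, |(Λ b - Λ a : Lp ℝ 2 circ) s| ≤ ∫ τ in Ioc a b, |D (τ, s)| := by
    filter_upwards [hΛ a ⟨ha, hab.trans hb⟩, hΛ b ⟨ha.trans hab, hb⟩,
      Lp.coeFn_sub (Λ b) (Λ a), ae_intervalIntegrable_slice hT hD] with s h1 h2 h3 h4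
    rw [h3, Pi.sub_apply, h1, h2, add_sub_add_left_eq_sub,
      intervalIntegral.integral_interval_sub_left, intervalIntegral.integral_of_le hab]
    · exact norm_integral_le_integral_norm (μ := volume.restrict (Ioc a b)) fun τ => D (τ, s)
    · exact h4.mono_set (by
        rw [uIcc_of_le (ha.trans hab), uIcc_of_le hT]; exact Icc_subset_Icc_right hb)
    · exact h4.mono_set (by
        rw [uIcc_of_le ha, uIcc_of_le hT]; exact Icc_subset_Icc_right (hab.trans hb))
  rw [intervalIntegral.integral_of_le hab,
    integral_integral_swap (f := fun τ s => |D (τ, s)|) hDs.abs]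
  exact integral_mono_ae (lp_integrable _).abs hDs.abs.integral_prod_right h1

/-- The chain rule for `‖Λ - v‖²`. -/
theorem norm_sub_sq_sub (hDs : StronglyMeasurable D)
    (hD : Integrable D ((volume.restrict (Ioc 0 T)).prod circ))
    (hΛ : ∀ t ∈ Icc 0 T, Λ t =ᵐ[circ] fun s => Λ 0 s + ∫ τ in 0..t, D (τ, s)) {K : ℝ}
    (hK : ∀ᵐ τ ∂(volume.restrict (Ioc 0 T)), ∀ᵐ s ∂circ, |Λ τ s| ≤ K) {v : Lp ℝ 2 circ}
    (hv : ∀ᵐ s ∂circ, |v s| ≤ K) {a b : ℝ} (ha : 0 ≤ a) (hab : a ≤ b) (hb : b ≤ T) :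
    IntervalIntegrable (fun τ => ∫ s, D (τ, s) * (Λ τ s - v s) ∂circ) volume a b ∧
    ‖Λ b - v‖ ^ 2 - ‖Λ a - v‖ ^ 2 = 2 * ∫ τ in a..b, ∫ s, D (τ, s) * (Λ τ s - v s) ∂circ := by
  have hT : 0 ≤ T := ha.trans (hab.trans hb)
  obtain ⟨u, hu, hue⟩ := exists_stronglyMeasurable_primitive hDs (Λ 0)
  have hDst := integrable_strip hD ha hb
  have hΛu : ∀ t ∈ Icc 0 T, Λ t =ᵐ[circ] fun s => u (t, s) := by
    intro t ht
    filter_upwards [hΛ t ht] with s hs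
    rw [hs, hue t ht.1]
  have hK' : ∀ᵐ τ ∂(volume.restrict (Ioc a b)), ∀ᵐ s ∂circ, |Λ τ s| ≤ K :=
    ae_mono (Measure.restrict_mono (Ioc_subset_Ioc ha hb) le_rfl) hK
  have hmem : ∀ᵐ τ ∂(volume.restrict (Ioc a b)), τ ∈ Ioc a b := ae_restrict_mem measurableSet_Ioc
  have hvm : StronglyMeasurable fun z : ℝ × ℝ => v z.2 :=
    (Lp.stronglyMeasurable v).comp_measurable measurable_snd
  have hbd : ∀ᵐ z ∂((volume.restrict (Ioc a b)).prod circ), ‖u z - v z.2‖ ≤ 2 * K := by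
    have hmeas : MeasurableSet {z : ℝ × ℝ | ‖u z - v z.2‖ ≤ 2 * K} :=
      measurableSet_le (hu.sub hvm).measurable.norm measurable_const
    rw [Measure.ae_prod_iff_ae_ae hmeas]
    filter_upwards [hK', hmem] with τ h1 h2
    filter_upwards [h1, hΛu τ ⟨ha.trans h2.1.le, h2.2.trans hb⟩, hv] with s h3 h4 h5
    rw [← h4]
    calc ‖Λ τ s - v s‖ ≤ ‖Λ τ s‖ + ‖v s‖ := norm_sub_le _ _
      _ ≤ K + K := add_le_add h3 h5
      _ = 2 * K := by ring
  have hprod : Integrable (fun z : ℝ × ℝ => D z * (u z - v z.2))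
      ((volume.restrict (Ioc a b)).prod circ) :=
    hDst.mul_bdd (c := 2 * K) (hu.sub hvm).aestronglyMeasurable hbd
  have hswap : ∀ᵐ τ ∂(volume.restrict (Ioc a b)),
      ∫ s, D (τ, s) * (u (τ, s) - v s) ∂circ = ∫ s, D (τ, s) * (Λ τ s - v s) ∂circ := by
    filter_upwards [hmem] with τ h2
    refine integral_congr_ae ?_
    filter_upwards [hΛu τ ⟨ha.trans h2.1.le, h2.2.trans hb⟩] with s hs
    rw [hs]
  refine ⟨?_, ?_⟩
  · exact (intervalIntegrable_iff_integrableOn_Ioc_of_le hab).2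
      (hprod.integral_prod_left.congr hswap)
  have hpt : ∀ᵐ s ∂circ, (Λ b - v : Lp ℝ 2 circ) s ^ 2 - (Λ a - v : Lp ℝ 2 circ) s ^ 2 =
      2 * ∫ τ in Ioc a b, D (τ, s) * (u (τ, s) - v s) := by
    filter_upwards [hΛu a ⟨ha, hab.trans hb⟩, hΛu b ⟨ha.trans hab, hb⟩,
      Lp.coeFn_sub (Λ b) v, Lp.coeFn_sub (Λ a) v, ae_intervalIntegrable_slice hT hD]
      with s h1 h2 h3 h4 h5
    rw [h3, h4, Pi.sub_apply, Pi.sub_apply, h1, h2, hue a ha, hue b (ha.trans hab)]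
    set y : ℝ → ℝ := fun t => (Λ 0 s - v s) + ∫ τ in 0..t, D (τ, s) with hy
    have hsub : uIcc a b ⊆ uIcc 0 T := by
      rw [uIcc_of_le hab, uIcc_of_le hT]; exact Icc_subset_Icc ha hb
    have hyAC : AbsolutelyContinuousOnInterval y a b :=
      ((LipschitzWith.const (Λ 0 s - v s)).lipschitzOnWith.absolutelyContinuousOnInterval.add
        (h5.absolutelyContinuousOnInterval_intervalIntegral left_mem_uIcc)).mono hsub
    have e1 := hyAC.integral_deriv_mul_eq_sub hyAC
    have e2 : ∫ τ in a..b, (deriv y τ * y τ + y τ * deriv y τ) =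
        ∫ τ in a..b, 2 * (D (τ, s) * (u (τ, s) - v s)) := by
      refine intervalIntegral.integral_congr_ae ?_
      filter_upwards [h5.ae_hasDerivAt_integral] with τ h6 h7
      have h8 : τ ∈ uIcc 0 T := hsub (uIoc_subset_uIcc h7)
      have h9 : deriv y τ = D (τ, s) := ((h6 h8 0 left_mem_uIcc).const_add _).deriv
      rw [uIcc_of_le hT] at h8
      rw [h9, hue τ h8.1]
      simp only [hy]; ring
    rw [e2, intervalIntegral.integral_const_mul, intervalIntegral.integral_of_le hab] at e1
    rw [e1]
    simp only [hy]; ring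
  rw [lp_norm_sq, lp_norm_sq, ← integral_sub (lp_integrable_sq _) (lp_integrable_sq _),
    integral_congr_ae hpt, integral_const_mul, intervalIntegral.integral_of_le hab,
    ← integral_congr_ae hswap,
    integral_integral_swap (f := fun τ s => D (τ, s) * (u (τ, s) - v s)) hprod]

end TimeDerivative

/-! ### The error of the implicit Euler scheme -/

theorem le_on_Icc_of_ae_le {T : ℝ} (hT : 0 < T) {f g : ℝ → ℝ} (hf : ContinuousOn f (Icc 0 T))
    (hg : ContinuousOn g (Icc 0 T)) (h : ∀ᵐ t ∂(volume.restrict (Ioc 0 T)), f t ≤ g t) :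
    ∀ t ∈ Icc 0 T, f t ≤ g t := by
  rw [Measure.restrict_congr_set Ioc_ae_eq_Icc] at h
  have h1 : (fun t => max (f t) (g t)) =ᵐ[volume.restrict (Icc 0 T)] g := by
    filter_upwards [h] with t ht using max_eq_right ht
  have h2 := Measure.eqOn_Icc_of_ae_eq volume hT.ne h1 (hf.sup hg) hg
  intro t ht
  exact max_eq_right_iff.1 (h2 ht)

theorem integral_abs_le_norm (f : Lp ℝ 2 circ) :
    ∫ s, |f s| ∂circ ≤ Real.sqrt (2 * Real.pi) * ‖f‖ := by
  have hpi := Real.two_pi_pos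
  set I := ∫ s, |f s| ∂circ with hI
  set m := I / (2 * Real.pi) with hm
  have h0 : 0 ≤ ∫ s, (|f s| - m) ^ 2 ∂circ := integral_nonneg fun s => sq_nonneg _
  have h1 : ∫ s, (|f s| - m) ^ 2 ∂circ = ‖f‖ ^ 2 - 2 * m * I + m ^ 2 * (2 * Real.pi) := by
    have e : ∀ s, (|f s| - m) ^ 2 = (f s ^ 2 - 2 * m * |f s|) + m ^ 2 := fun s => by
      rw [sub_sq, sq_abs]; ring
    have i : Integrable (fun s => f s ^ 2 - 2 * m * |f s|) circ :=
      (lp_integrable_sq f).sub ((lp_integrable f).abs.const_mul _)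
    simp only [e]
    rw [integral_add i (integrable_const _), integral_sub (lp_integrable_sq f) ((lp_integrable f).abs.const_mul _),
      integral_const_mul, integral_const, circ_real_univ, lp_norm_sq, smul_eq_mul]
    ring
  have h2 : I = m * (2 * Real.pi) := by rw [hm]; field_simp
  have h3 : I ^ 2 ≤ (2 * Real.pi) * ‖f‖ ^ 2 := by
    rw [h1] at h0
    have h4 : m * I ≤ ‖f‖ ^ 2 := by
      have : m ^ 2 * (2 * Real.pi) = m * I := by rw [h2]; ring
      linarith
    calc I ^ 2 = (2 * Real.pi) * (m * I) := by rw [sq]; nth_rw 1 [h2]; ring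
      _ ≤ _ := by gcongr
  refine abs_le_of_sq_le_sq' ?_ (by positivity) |>.2
  rw [mul_pow, Real.sq_sqrt hpi.le]
  exact h3

/-- `ω₁' - ω₂'` acts monotonically: the operator `u ↦ - ∂_s ∂J(u_s + s)` is monotone in `L_2(S)`. -/
theorem integral_deriv_sub_mul_sub_nonpos {u₁ u₂ p₁ p₂ ω₁ ω₂ : ℝ → ℝ} (h₁ : HasWeakDeriv u₁ p₁)
    (h₂ : HasWeakDeriv u₂ p₂) (hω₁ : AbsolutelyContinuousOnInterval ω₁ 0 (2 * Real.pi))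
    (hω₂ : AbsolutelyContinuousOnInterval ω₂ 0 (2 * Real.pi))
    (hp₁ : ω₁ (2 * Real.pi) = ω₁ 0 + 2 * Real.pi) (hp₂ : ω₂ (2 * Real.pi) = ω₂ 0 + 2 * Real.pi)
    (hJ₁ : ∀ᵐ s ∂circ, ω₁ s ∈ subdiff J (p₁ s + s))
    (hJ₂ : ∀ᵐ s ∂circ, ω₂ s ∈ subdiff J (p₂ s + s)) :
    ∫ s, (deriv ω₁ s - deriv ω₂ s) * (u₁ s - u₂ s) ∂circ ≤ 0 := by
  obtain ⟨F, hF, hFu⟩ := (h₁.sub h₂).exists_primitive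
  have hW := hω₁.sub hω₂
  have hFAC := hF.absCont 0 (2 * Real.pi)
  have e1 := hFAC.integral_mul_deriv_eq_deriv_mul hW
  have hd : ∀ᵐ s ∂circ, deriv (fun s => ω₁ s - ω₂ s) s = deriv ω₁ s - deriv ω₂ s := by
    rw [ae_circ_iff]
    filter_upwards [hω₁.ae_differentiableAt, hω₂.ae_differentiableAt] with s h1 h2 hs
    have hs' : s ∈ uIcc 0 (2 * Real.pi) := by
      rw [uIcc_of_le Real.two_pi_pos.le]; exact Ioc_subset_Icc_self hs
    exact deriv_fun_sub (h1 hs') (h2 hs')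
  have e2 : ∫ s, (deriv ω₁ s - deriv ω₂ s) * (u₁ s - u₂ s) ∂circ =
      ∫ s, F s * deriv (fun s => ω₁ s - ω₂ s) s ∂circ := by
    refine integral_congr_ae ?_
    filter_upwards [hd, hFu] with s h3 h4
    rw [h3, h4, mul_comm]
  rw [e2, integral_circ]
  refine e1.le.trans ?_
  simp only [Pi.sub_apply]
  rw [hF.zero_eq, hp₁, hp₂, ← integral_circ]
  have h0 : 0 ≤ ∫ s, deriv F s * (ω₁ s - ω₂ s) ∂circ := by
    refine integral_nonneg_of_ae ?_
    filter_upwards [hJ₁, hJ₂, ae_circ_of_ae hF.ae_deriv_eq, perExt_ae_eq fun s => p₁ s - p₂ s]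
      with s h3 h4 h5 h6
    rw [h5, h6]
    have := subdiff_monotone h3 h4
    simp only [Pi.zero_apply]
    nlinarith
  linarith

theorem memLp_semiDiscrete {T h : ℝ} {Λ : ℝ → Lp ℝ 2 circ} {Λ₀ : ℝ → ℝ} {lam : ℕ → ℝ → ℝ}
    (hlam : IsSemiDiscreteSolution T h Λ₀ lam) (h0 : Λ 0 =ᵐ[circ] Λ₀) {k : ℕ}
    (hk : k ≤ ⌊T / h⌋₊) : MemLp (lam k) 2 circ := by
  rcases Nat.eq_zero_or_pos k with rfl | hk0
  · exact (memLp_congr_ae (hlam.1.trans h0.symm)).2 (Lp.memLp (Λ 0))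
  · obtain ⟨hu, -⟩ := hlam.2 k hk0 hk
    obtain ⟨B, hB⟩ := hu.exists_bound
    refine MemLp.of_bound (integrable_circ_iff.2 hu.continuousOn.intervalIntegrable).1 B ?_
    filter_upwards [ae_circ_mem] with s hs
    refine hB s ?_
    rw [uIcc_of_le Real.two_pi_pos.le]; exact Ioc_subset_Icc_self hs

/-- `D` is the time derivative of the weak solution `Λ`, whose spatial derivative `Λs` stays in a
ball of `TV(S)`; at almost every time, `D` is the derivative of a selection of `∂J(Λs + s)` that is
periodic up to the identity. -/
structure IsStrongSolution (T : ℝ) (M : ℝ≥0∞) (Λ : ℝ → Lp ℝ 2 circ) (Λs : ℝ → ℝ → ℝ)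
    (D : ℝ × ℝ → ℝ) : Prop where
  pos : 0 < T
  lt_top : M < ⊤
  continuousOn : ContinuousOn Λ (Icc 0 T)
  stronglyMeasurable : StronglyMeasurable D
  integrable : Integrable D ((volume.restrict (Ioc 0 T)).prod circ)
  primitive : ∀ t ∈ Icc 0 T, Λ t =ᵐ[circ] fun s => Λ 0 s + ∫ τ in 0..t, D (τ, s)
  hasWeakDeriv : ∀ᵐ τ ∂(volume.restrict (Ioc 0 T)), HasWeakDeriv (Λ τ) (Λs τ)
  tvNorm_le : ∀ᵐ τ ∂(volume.restrict (Ioc 0 T)), tvNorm (Λs τ) ≤ M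
  selection : ∀ᵐ τ ∂(volume.restrict (Ioc 0 T)), ∃ ω : ℝ → ℝ,
    AbsolutelyContinuousOnInterval ω 0 (2 * Real.pi) ∧ ω (2 * Real.pi) = ω 0 + 2 * Real.pi ∧
    (∀ᵐ s ∂circ, ω s ∈ subdiff J (Λs τ s + s)) ∧ (fun s => D (τ, s)) =ᵐ[circ] deriv ω

theorem IsWeakSolution.exists_isStrongSolution {T : ℝ} (hT : 0 < T) {Λ₀ : ℝ → ℝ}
    {Λ : ℝ → Lp ℝ 2 circ} (h : IsWeakSolution T Λ₀ Λ) :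
    ∃ M Λs D, IsStrongSolution T M Λ Λs D ∧
      AEStronglyMeasurable (fun z : ℝ × ℝ => Λs z.1 z.2) ((volume.restrict (Ioc 0 T)).prod circ) := by
  obtain ⟨hc, -, Λs, Ω, hm, hwd, ⟨M, hM, htv⟩, -, hAC, hint, hJ, hw⟩ := h
  obtain ⟨D, h1, h2, h3, h4, h5⟩ := exists_time_derivative hT hAC hint hw
  rw [restrict_Ioo_eq_restrict_Ioc] at hm hwd htv hAC hJ
  refine ⟨M, Λs, D, ⟨hT, hM, hc, h1, h2, h5, hwd, htv, ?_⟩, hm⟩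
  filter_upwards [hAC, h3, h4, Measure.ae_ae_of_ae_prod hJ] with τ a1 a2 a3 a4
  exact ⟨Ω τ, a1, a3, a4, a2⟩

namespace IsStrongSolution

variable {T : ℝ} {M : ℝ≥0∞} {Λ : ℝ → Lp ℝ 2 circ} {Λs : ℝ → ℝ → ℝ} {D : ℝ × ℝ → ℝ}

theorem exists_ae_bound (hS : IsStrongSolution T M Λ Λs D) :
    ∃ K, ∀ᵐ τ ∂(volume.restrict (Ioc 0 T)), ∀ᵐ s ∂circ, |Λ τ s| ≤ K := by
  obtain ⟨R, hR⟩ := isCompact_Icc.exists_bound_of_continuousOn hS.continuousOn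
  set L := (M + (M + 1) * ENNReal.ofReal (2 * Real.pi)).toReal with hL
  have hL0 : 0 ≤ L := ENNReal.toReal_nonneg
  refine ⟨Real.sqrt ((2 * Real.pi)⁻¹ * R ^ 2 + 2 * L * (Real.sqrt (2 * Real.pi) * R)), ?_⟩
  filter_upwards [hS.hasWeakDeriv, hS.tvNorm_le, ae_restrict_mem measurableSet_Ioc]
    with τ h1 h2 h3
  filter_upwards [h1.ae_sq_le (ae_abs_le_of_tvNorm_le hS.lt_top h2)] with s hs
  refine Real.abs_le_sqrt (hs.trans ?_)
  rw [← lp_norm_sq]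
  have hn := hR τ (Ioc_subset_Icc_self h3)
  have h4 := (integral_abs_le_norm (Λ τ)).trans
    (mul_le_mul_of_nonneg_left hn (Real.sqrt_nonneg _))
  have h5 := Real.two_pi_pos
  gcongr

theorem intervalIntegrable_norm (hS : IsStrongSolution T M Λ Λs D) {a b : ℝ} (ha : a ∈ Icc 0 T)
    (hb : b ∈ Icc 0 T) : IntervalIntegrable (fun τ => ∫ s, |D (τ, s)| ∂circ) volume a b := by
  have h1 : IntegrableOn (fun τ => ∫ s, |D (τ, s)| ∂circ) (Ioc 0 T) :=
    hS.integrable.abs.integral_prod_left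
  have h2 := (intervalIntegrable_iff_integrableOn_Ioc_of_le hS.pos.le).2 h1
  refine h2.mono_set ?_
  rw [uIcc_of_le hS.pos.le]
  exact uIcc_subset_Icc ha hb

/-- Increments of a strong solution are small in `L_∞(S)`, so that their squared `L_2(S)` norm is
much smaller than their `L_1(S)` norm. -/
theorem exists_norm_sub_sq_le (hS : IsStrongSolution T M Λ Λs D) {δ : ℝ} (hδ : 0 < δ) :
    ∃ h₀ > 0, ∀ a b, 0 ≤ a → a ≤ b → b ≤ T → b - a ≤ h₀ →
      ‖Λ b - Λ a‖ ^ 2 ≤ δ * ∫ τ in a..b, ∫ s, |D (τ, s)| ∂circ := by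
  have hpi := Real.two_pi_pos
  set m : ℝ → ℝ := fun τ => ∫ s, |D (τ, s)| ∂circ with hm
  have hm0 : ∀ τ, 0 ≤ m τ := fun τ => integral_nonneg fun s => abs_nonneg _
  set L := (M + (M + 1) * ENNReal.ofReal (2 * Real.pi)).toReal with hL
  have hL0 : 0 ≤ L := ENNReal.toReal_nonneg
  set G : ℝ → ℝ := fun t => ∫ τ in 0..t, m τ with hG
  have hGc : ContinuousOn G (Icc 0 T) := by
    have := intervalIntegral.continuousOn_primitive_interval' (b₁ := 0) (b₂ := T) (a := 0)
      (hS.intervalIntegrable_norm ⟨le_rfl, hS.pos.le⟩ ⟨hS.pos.le, le_rfl⟩) left_mem_uIcc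
    rwa [uIcc_of_le hS.pos.le] at this
  have hGsub : ∀ a ∈ Icc 0 T, ∀ b ∈ Icc 0 T, G b - G a = ∫ τ in a..b, m τ := fun a ha b hb =>
    intervalIntegral.integral_interval_sub_left
      (hS.intervalIntegrable_norm ⟨le_rfl, hS.pos.le⟩ hb)
      (hS.intervalIntegrable_norm ⟨le_rfl, hS.pos.le⟩ ha)
  set Ψ : ℝ → ℝ := fun x => Real.sqrt ((2 * Real.pi)⁻¹ * x ^ 2 +
    2 * (L + L) * (Real.sqrt (2 * Real.pi) * x)) with hΨ
  have hΨc : Continuous Ψ := by fun_prop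
  have hΨ0 : Ψ 0 = 0 := by simp [hΨ]
  have hI : ∀ a ∈ Icc 0 T, ∀ b ∈ Icc 0 T, ∫ s, |(Λ b - Λ a : Lp ℝ 2 circ) s| ∂circ ≤ |G b - G a| := by
    have key : ∀ a ∈ Icc 0 T, ∀ b ∈ Icc 0 T, a ≤ b →
        ∫ s, |(Λ b - Λ a : Lp ℝ 2 circ) s| ∂circ ≤ |G b - G a| := by
      intro a ha b hb hab
      rw [hGsub a ha b hb]
      exact (integral_abs_sub_le hS.integrable hS.primitive ha.1 hab hb.2).trans (le_abs_self _)
    intro a ha b hb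
    rcases le_total a b with h | h
    · exact key a ha b hb h
    · have := key b hb a ha h
      rw [abs_sub_comm] at this
      refine le_trans (le_of_eq ?_) this
      refine integral_congr_ae ?_
      filter_upwards [Lp.coeFn_sub (Λ b) (Λ a), Lp.coeFn_sub (Λ a) (Λ b)] with s h1 h2
      rw [h1, h2, Pi.sub_apply, Pi.sub_apply, abs_sub_comm]
  -- the inequality at regular times
  have hae : ∀ᵐ a ∂(volume.restrict (Ioc 0 T)), ∀ᵐ b ∂(volume.restrict (Ioc 0 T)),
      ‖Λ b - Λ a‖ ^ 2 ≤ |G b - G a| * Ψ ‖Λ b - Λ a‖ := by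
    filter_upwards [hS.hasWeakDeriv, hS.tvNorm_le, ae_restrict_mem measurableSet_Ioc]
      with a a1 a2 a3
    filter_upwards [hS.hasWeakDeriv, hS.tvNorm_le, ae_restrict_mem measurableSet_Ioc]
      with b b1 b2 b3
    have hd : ∀ᵐ s ∂circ, |Λs b s - Λs a s| ≤ L + L := by
      filter_upwards [ae_abs_le_of_tvNorm_le hS.lt_top a2, ae_abs_le_of_tvNorm_le hS.lt_top b2]
        with s h1 h2
      exact (abs_sub _ _).trans (add_le_add h2 h1)
    have hw := (b1.sub a1).congr (Lp.coeFn_sub (Λ b) (Λ a)).symm (ae_eq_refl _)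
    have hsup := hw.ae_sq_le hd
    rw [← lp_norm_sq] at hsup
    have h1 : ∀ᵐ s ∂circ, |(Λ b - Λ a : Lp ℝ 2 circ) s| ≤ Ψ ‖Λ b - Λ a‖ := by
      filter_upwards [hsup] with s hs
      refine Real.abs_le_sqrt (hs.trans ?_)
      have := integral_abs_le_norm (Λ b - Λ a)
      gcongr
    have h2 : ∫ s, (Λ b - Λ a : Lp ℝ 2 circ) s ^ 2 ∂circ ≤
        ∫ s, |(Λ b - Λ a : Lp ℝ 2 circ) s| * Ψ ‖Λ b - Λ a‖ ∂circ := by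
      refine integral_mono_ae (lp_integrable_sq _) ((lp_integrable _).abs.mul_const _) ?_
      filter_upwards [h1] with s hs
      rw [← sq_abs, sq]
      exact mul_le_mul_of_nonneg_left hs (abs_nonneg _)
    rw [← lp_norm_sq, integral_mul_const] at h2
    exact h2.trans (mul_le_mul_of_nonneg_right
      (hI a (Ioc_subset_Icc_self a3) b (Ioc_subset_Icc_self b3)) (Real.sqrt_nonneg _))
  -- both sides depend continuously on the two times
  have hall : ∀ b ∈ Icc 0 T, ∀ a ∈ Icc 0 T,
      ‖Λ b - Λ a‖ ^ 2 ≤ |G b - G a| * Ψ ‖Λ b - Λ a‖ := by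
    have h1 : ∀ᵐ a ∂(volume.restrict (Ioc 0 T)), ∀ b ∈ Icc 0 T,
        ‖Λ b - Λ a‖ ^ 2 ≤ |G b - G a| * Ψ ‖Λ b - Λ a‖ := by
      filter_upwards [hae] with a ha
      have hn : ContinuousOn (fun b => ‖Λ b - Λ a‖) (Icc 0 T) :=
        (hS.continuousOn.sub continuousOn_const).norm
      exact le_on_Icc_of_ae_le hS.pos (hn.pow 2)
        ((hGc.sub continuousOn_const).abs.mul (hΨc.comp_continuousOn hn)) ha
    intro b hb
    have hn : ContinuousOn (fun a => ‖Λ b - Λ a‖) (Icc 0 T) :=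
      (continuousOn_const.sub hS.continuousOn).norm
    refine le_on_Icc_of_ae_le hS.pos (hn.pow 2)
      ((continuousOn_const.sub hGc).abs.mul (hΨc.comp_continuousOn hn)) ?_
    filter_upwards [h1] with a ha using ha b hb
  have hΨt : ∀ᶠ x in 𝓝 (0 : ℝ), Ψ x < δ := by
    have := hΨc.tendsto 0
    rw [hΨ0] at this
    exact this.eventually (gt_mem_nhds hδ)
  obtain ⟨x₀, hx₀, hΨx⟩ := Metric.eventually_nhds_iff.1 hΨt
  have huc := isCompact_Icc.uniformContinuousOn_of_continuous hS.continuousOn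
  rw [Metric.uniformContinuousOn_iff] at huc
  obtain ⟨h₁, hh₁, huc⟩ := huc x₀ hx₀
  refine ⟨h₁ / 2, half_pos hh₁, fun a b ha hab hb hlt => ?_⟩
  have ha' : a ∈ Icc 0 T := ⟨ha, hab.trans hb⟩
  have hb' : b ∈ Icc 0 T := ⟨ha.trans hab, hb⟩
  have h2 := hall b hb' a ha'
  have h3 : Ψ ‖Λ b - Λ a‖ ≤ δ := by
    refine (hΨx ?_).le
    rw [Real.dist_eq, sub_zero, abs_of_nonneg (norm_nonneg _), ← dist_eq_norm]
    refine huc b hb' a ha' ?_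
    rw [Real.dist_eq, abs_of_nonneg (by linarith)]
    linarith
  have h4 : 0 ≤ ∫ τ in a..b, m τ := intervalIntegral.integral_nonneg hab fun τ _ => hm0 τ
  rw [hGsub a ha' b hb', abs_of_nonneg h4] at h2
  calc ‖Λ b - Λ a‖ ^ 2 ≤ (∫ τ in a..b, m τ) * Ψ ‖Λ b - Λ a‖ := h2
    _ ≤ (∫ τ in a..b, m τ) * δ := by gcongr
    _ = δ * ∫ τ in a..b, m τ := mul_comm _ _

/-- The error of one implicit step. -/
theorem norm_sub_sq_step_le (hS : IsStrongSolution T M Λ Λs D) {h : ℝ} (hh : 0 < h)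
    {u u' : ℝ → ℝ} {v v' : Lp ℝ 2 circ} (hv : v =ᵐ[circ] u) (hv' : v' =ᵐ[circ] u')
    (hstep : IsImplicitStep h u' u) {a : ℝ} (ha : 0 ≤ a) (hb : a + h ≤ T) :
    ‖Λ (a + h) - v‖ ^ 2 ≤ ‖Λ a - v'‖ ^ 2 + h⁻¹ * ∫ τ in a..a + h, ‖Λ τ - Λ a‖ ^ 2 := by
  obtain ⟨hu, hu0, ω, hω, hω2, hJ, hE⟩ := hstep
  have hab : a ≤ a + h := by linarith
  have huw := hasWeakDeriv_of_absCont hu hu0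
  obtain ⟨B, hB⟩ := hu.exists_bound
  obtain ⟨K, hK⟩ := hS.exists_ae_bound
  have hvK : ∀ᵐ s ∂circ, |v s| ≤ max K B := by
    filter_upwards [hv, ae_circ_mem] with s h1 h2
    rw [h1]
    refine (hB s ?_).trans (le_max_right _ _)
    rw [uIcc_of_le Real.two_pi_pos.le]; exact Ioc_subset_Icc_self h2
  have hK' : ∀ᵐ τ ∂(volume.restrict (Ioc 0 T)), ∀ᵐ s ∂circ, |Λ τ s| ≤ max K B := by
    filter_upwards [hK] with τ h1
    filter_upwards [h1] with s h2 using h2.trans (le_max_left _ _)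
  obtain ⟨hint, hchain⟩ := norm_sub_sq_sub hS.stronglyMeasurable hS.integrable hS.primitive hK' hvK
    ha hab hb
  have hcont : ContinuousOn Λ (Icc a (a + h)) := hS.continuousOn.mono (Icc_subset_Icc ha hb)
  -- monotonicity at almost every time
  have hmono : ∀ᵐ τ ∂(volume.restrict (Ioc a (a + h))),
      ∫ s, D (τ, s) * (Λ τ s - v s) ∂circ ≤ h⁻¹ * inner ℝ (v - v') (Λ τ - v) := by
    refine ae_mono (Measure.restrict_mono (Ioc_subset_Ioc ha hb) le_rfl) ?_
    filter_upwards [hS.hasWeakDeriv, hS.selection, hK', hS.integrable.prod_right_ae]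
      with τ h1 ⟨ω₁, h2, h3, h4, h5⟩ h6 h7
    have hmon := integral_deriv_sub_mul_sub_nonpos h1 huw h2 hω h3 hω2 h4 hJ
    have hωi : Integrable (deriv ω) circ := integrable_circ_iff.2 hω.intervalIntegrable_deriv
    have hbd : ∀ᵐ s ∂circ, ‖Λ τ s - v s‖ ≤ max K B + max K B := by
      filter_upwards [h6, hvK] with s a1 a2
      exact (norm_sub_le _ _).trans (add_le_add a1 a2)
    have hm : AEStronglyMeasurable (fun s => Λ τ s - v s) circ :=
      ((lp_integrable (Λ τ)).sub (lp_integrable v)).1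
    have i1 : Integrable (fun s => D (τ, s) * (Λ τ s - v s)) circ := h7.mul_bdd hm hbd
    have i2 : Integrable (fun s => deriv ω s * (Λ τ s - v s)) circ := hωi.mul_bdd hm hbd
    have e1 : ∫ s, (deriv ω₁ s - deriv ω s) * (Λ τ s - u s) ∂circ =
        ∫ s, D (τ, s) * (Λ τ s - v s) ∂circ - ∫ s, deriv ω s * (Λ τ s - v s) ∂circ := by
      rw [← integral_sub i1 i2]
      refine integral_congr_ae ?_
      filter_upwards [h5, hv] with s a1 a2
      rw [← a1, ← a2]; ring
    have e2 : ∫ s, deriv ω s * (Λ τ s - v s) ∂circ = h⁻¹ * inner ℝ (v - v') (Λ τ - v) := by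
      rw [lp_inner, ← integral_const_mul]
      refine integral_congr_ae ?_
      filter_upwards [hE, hv, hv', Lp.coeFn_sub v v', Lp.coeFn_sub (Λ τ) v] with s a1 a2 a3 a4 a5
      rw [← a1, a4, a5, Pi.sub_apply, Pi.sub_apply, a2, a3]; ring
    linarith
  have hci : IntervalIntegrable (fun τ => h⁻¹ * inner ℝ (v - v') (Λ τ - v)) volume a (a + h) := by
    refine ContinuousOn.intervalIntegrable ?_
    rw [uIcc_of_le hab]
    exact continuousOn_const.mul (continuousOn_const.inner (hcont.sub continuousOn_const))
  have hle : ∫ τ in a..a + h, ∫ s, D (τ, s) * (Λ τ s - v s) ∂circ ≤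
      ∫ τ in a..a + h, h⁻¹ * inner ℝ (v - v') (Λ τ - v) := by
    refine intervalIntegral.integral_mono_ae_restrict hab hint hci ?_
    rw [← Measure.restrict_congr_set Ioc_ae_eq_Icc]
    exact hmono
  have hci2 : IntervalIntegrable (fun τ => inner ℝ (v - v') (Λ τ - Λ a)) volume a (a + h) := by
    refine ContinuousOn.intervalIntegrable ?_
    rw [uIcc_of_le hab]
    exact continuousOn_const.inner (hcont.sub continuousOn_const)
  have hci3 : IntervalIntegrable (fun τ => ‖Λ τ - Λ a‖ ^ 2) volume a (a + h) := by
    refine ContinuousOn.intervalIntegrable ?_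
    rw [uIcc_of_le hab]
    exact (hcont.sub continuousOn_const).norm.pow 2
  have hsplit : ∫ τ in a..a + h, inner ℝ (v - v') (Λ τ - v) =
      (∫ τ in a..a + h, inner ℝ (v - v') (Λ τ - Λ a)) + h * inner ℝ (v - v') (Λ a - v) := by
    have : ∀ τ, inner ℝ (v - v') (Λ τ - v) =
        inner ℝ (v - v') (Λ τ - Λ a) + inner ℝ (v - v') (Λ a - v) := fun τ => by
      rw [← inner_add_right]; congr 1; abel
    rw [intervalIntegral.integral_congr fun τ _ => this τ, intervalIntegral.integral_add hci2 intervalIntegrable_const,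
      intervalIntegral.integral_const, add_sub_cancel_left, smul_eq_mul]
  have hyoung : 2 * ∫ τ in a..a + h, inner ℝ (v - v') (Λ τ - Λ a) ≤
      h * ‖v - v'‖ ^ 2 + ∫ τ in a..a + h, ‖Λ τ - Λ a‖ ^ 2 := by
    rw [← intervalIntegral.integral_const_mul]
    have e : h * ‖v - v'‖ ^ 2 = ∫ τ in a..a + h, ‖v - v'‖ ^ 2 := by
      rw [intervalIntegral.integral_const, add_sub_cancel_left, smul_eq_mul]
    rw [e, ← intervalIntegral.integral_add intervalIntegrable_const hci3]
    refine intervalIntegral.integral_mono_on hab (hci2.const_mul 2)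
      (intervalIntegrable_const.add hci3) fun τ _ => ?_
    have := norm_sub_sq_real (v - v') (Λ τ - Λ a)
    have := sq_nonneg ‖v - v' - (Λ τ - Λ a)‖
    linarith
  have hexp : ‖Λ a - v‖ ^ 2 = ‖Λ a - v'‖ ^ 2 - 2 * inner ℝ (v - v') (Λ a - v) - ‖v - v'‖ ^ 2 := by
    have e : Λ a - v' = (Λ a - v) + (v - v') := by abel
    rw [e, norm_add_sq_real, real_inner_comm]
    ring
  rw [intervalIntegral.integral_const_mul, hsplit, mul_add, ← mul_assoc h⁻¹ h,
    inv_mul_cancel₀ hh.ne', one_mul] at hle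
  have hy2 : h⁻¹ * (2 * ∫ τ in a..a + h, inner ℝ (v - v') (Λ τ - Λ a)) ≤
      ‖v - v'‖ ^ 2 + h⁻¹ * ∫ τ in a..a + h, ‖Λ τ - Λ a‖ ^ 2 := by
    have := mul_le_mul_of_nonneg_left hyoung (inv_pos.2 hh).le
    rwa [mul_add, ← mul_assoc h⁻¹ h, inv_mul_cancel₀ hh.ne', one_mul] at this
  linarith

/-- The error at the grid points. -/
theorem norm_sub_sq_grid_le (hS : IsStrongSolution T M Λ Λs D) {Λ₀ : ℝ → ℝ}
    (h0 : Λ 0 =ᵐ[circ] Λ₀) {h δ : ℝ} (hh : 0 < h) (hδ : 0 ≤ δ) {lam : ℕ → ℝ → ℝ}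
    (hlam : IsSemiDiscreteSolution T h Λ₀ lam)
    (hinc : ∀ a b, 0 ≤ a → a ≤ b → b ≤ T → b - a ≤ h →
      ‖Λ b - Λ a‖ ^ 2 ≤ δ * ∫ τ in a..b, ∫ s, |D (τ, s)| ∂circ)
    (k : ℕ) (hk : k ≤ ⌊T / h⌋₊) (v : Lp ℝ 2 circ) (hv : v =ᵐ[circ] lam k) :
    ‖Λ (k * h) - v‖ ^ 2 ≤ δ * ∫ τ in 0..k * h, ∫ s, |D (τ, s)| ∂circ := by
  set m : ℝ → ℝ := fun τ => ∫ s, |D (τ, s)| ∂circ with hm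
  have hm0 : ∀ τ, 0 ≤ m τ := fun τ => integral_nonneg fun s => abs_nonneg _
  have hgrid : ∀ j : ℕ, j ≤ ⌊T / h⌋₊ → (j : ℝ) * h ≤ T := fun j hj => by
    rw [← le_div_iff₀ hh]
    exact (Nat.cast_le.2 hj).trans (Nat.floor_le (div_nonneg hS.pos.le hh.le))
  induction k generalizing v with
  | zero =>
    have : Λ 0 = v := Lp.ext (h0.trans (hlam.1.symm.trans hv.symm))
    simp [this]
  | succ k ih =>
    have hk' : k ≤ ⌊T / h⌋₊ := by omega
    have hmem := memLp_semiDiscrete hlam h0 hk'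
    have hT1 := hgrid _ hk
    have hT0 := hgrid _ hk'
    have e : ((k + 1 : ℕ) : ℝ) * h = k * h + h := by push_cast; ring
    rw [e] at hT1 ⊢
    have hk0 : (0 : ℝ) ≤ k * h := by positivity
    have hstep := hS.norm_sub_sq_step_le hh hv hmem.coeFn_toLp (hlam.2 (k + 1) (by omega) hk)
      hk0 hT1
    have ihk := ih hk' _ hmem.coeFn_toLp
    have hii : ∀ {a b : ℝ}, a ∈ Icc 0 T → b ∈ Icc 0 T → IntervalIntegrable m volume a b :=
      fun ha hb => hS.intervalIntegrable_norm ha hb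
    have m0 : (0 : ℝ) ∈ Icc 0 T := ⟨le_rfl, hS.pos.le⟩
    have m1 : (k : ℝ) * h ∈ Icc 0 T := ⟨hk0, hT0⟩
    have m2 : (k : ℝ) * h + h ∈ Icc 0 T := ⟨by linarith, hT1⟩
    have hbound : ∫ τ in k * h..k * h + h, ‖Λ τ - Λ (k * h)‖ ^ 2 ≤
        h * (δ * ∫ τ in k * h..k * h + h, m τ) := by
      have hc : h * (δ * ∫ τ in k * h..k * h + h, m τ) =
          ∫ _ in k * h..k * h + h, (δ * ∫ τ in k * h..k * h + h, m τ) := by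
        rw [intervalIntegral.integral_const, add_sub_cancel_left, smul_eq_mul]
      rw [hc]
      refine intervalIntegral.integral_mono_on (by linarith) ?_ intervalIntegrable_const
        fun τ hτ => ?_
      · refine ContinuousOn.intervalIntegrable ?_
        rw [uIcc_of_le (by linarith)]
        exact ((hS.continuousOn.mono (Icc_subset_Icc hk0 hT1)).sub continuousOn_const).norm.pow 2
      · refine (hinc _ τ hk0 hτ.1 (hτ.2.trans hT1) (by linarith [hτ.2])).trans ?_
        refine mul_le_mul_of_nonneg_left ?_ hδ
        exact intervalIntegral.integral_mono_interval le_rfl hτ.1 hτ.2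
          (Eventually.of_forall hm0) (hii m1 m2)
    have hb2 : h⁻¹ * ∫ τ in k * h..k * h + h, ‖Λ τ - Λ (k * h)‖ ^ 2 ≤
        δ * ∫ τ in k * h..k * h + h, m τ := by
      have := mul_le_mul_of_nonneg_left hbound (inv_pos.2 hh).le
      rwa [← mul_assoc h⁻¹ h, inv_mul_cancel₀ hh.ne', one_mul] at this
    have hadd := intervalIntegral.integral_add_adjacent_intervals (hii m0 m1) (hii m1 m2)
    rw [← hadd, mul_add]
    linarith

end IsStrongSolution

/-! ### The interpolant, and uniform convergence in time -/

theorem floor_div_le {T h t : ℝ} (hh : 0 < h) (htT : t ≤ T) : ⌊t / h⌋₊ ≤ ⌊T / h⌋₊ :=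
  Nat.floor_mono (div_le_div_of_nonneg_right htT hh.le)

theorem mem_Ico_floor {h t : ℝ} (hh : 0 < h) (ht : 0 ≤ t) :
    t ∈ Ico ((⌊t / h⌋₊ : ℝ) * h) ((⌊t / h⌋₊ + 1 : ℝ) * h) := by
  refine ⟨?_, ?_⟩
  · rw [← le_div_iff₀ hh]; exact Nat.floor_le (div_nonneg ht hh.le)
  · rw [← div_lt_iff₀ hh]; exact Nat.lt_floor_add_one _

theorem interpolant_eq {T h t : ℝ} (hh : 0 < h) (ht : 0 ≤ t) (htT : t ≤ T) (lam : ℕ → ℝ → ℝ) :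
    interpolant T h lam t = lam ⌊t / h⌋₊ := by
  have hmem := mem_Ico_floor hh ht
  funext s
  rw [interpolant, Finset.sum_eq_single ⌊t / h⌋₊]
  · rw [indicator_of_mem hmem]
  · intro j _ hj
    refine indicator_of_notMem (fun hm => hj ?_) _
    have h1 : (j : ℝ) ≤ t / h := (le_div_iff₀ hh).2 hm.1
    have h2 : t / h < j + 1 := (div_lt_iff₀ hh).2 hm.2
    exact ((Nat.floor_eq_iff (div_nonneg ht hh.le)).2 ⟨h1, h2⟩).symm
  · intro hn
    exact absurd (Finset.mem_range.2 (Nat.lt_succ_of_le (floor_div_le hh htT))) hn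

theorem aestronglyMeasurable_interpolant {T h : ℝ} {p : ℕ → ℝ → ℝ}
    (hp : ∀ k ≤ ⌊T / h⌋₊, AEStronglyMeasurable (p k) circ) (ν : Measure ℝ) [SFinite ν] :
    AEStronglyMeasurable (fun z : ℝ × ℝ => interpolant T h p z.1 z.2) (ν.prod circ) := by
  unfold interpolant
  refine Finset.aestronglyMeasurable_fun_sum _ fun k hk => ?_
  have h1 := (hp k (Nat.lt_succ_iff.1 (Finset.mem_range.1 hk))).comp_snd (μ := ν)
  have h2 := h1.indicator ((measurableSet_Ico (a := (k : ℝ) * h) (b := (k + 1 : ℝ) * h)).preimage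
    measurable_fst)
  exact h2

/-- The implicit Euler scheme converges in `L_2(S)`, uniformly in time. -/
theorem IsStrongSolution.eventually_norm_sub_le {T : ℝ} {M : ℝ≥0∞} {Λ : ℝ → Lp ℝ 2 circ}
    {Λs : ℝ → ℝ → ℝ} {D : ℝ × ℝ → ℝ} (hS : IsStrongSolution T M Λ Λs D) {Λ₀ : ℝ → ℝ}
    (h0 : Λ 0 =ᵐ[circ] Λ₀) {lam : ℝ → ℕ → ℝ → ℝ}
    (hlam : ∀ h : ℝ, 0 < h → IsSemiDiscreteSolution T h Λ₀ (lam h)) {δ : ℝ} (hδ : 0 < δ) :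
    ∀ᶠ h in 𝓝[>] (0 : ℝ), 0 < h ∧ ∀ t ∈ Ioc 0 T, ∃ v : Lp ℝ 2 circ,
      v =ᵐ[circ] interpolant T h (lam h) t ∧ ‖Λ t - v‖ ≤ δ := by
  set m : ℝ → ℝ := fun τ => ∫ s, |D (τ, s)| ∂circ with hm
  have hm0 : ∀ τ, 0 ≤ m τ := fun τ => integral_nonneg fun s => abs_nonneg _
  set I := ∫ τ in 0..T, m τ with hI
  have hI0 : 0 ≤ I := intervalIntegral.integral_nonneg hS.pos.le fun τ _ => hm0 τ
  set δ' := (δ / 2) ^ 2 / (I + 1) with hδ'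
  have hδ'0 : 0 < δ' := by positivity
  have hδ'I : δ' * I ≤ (δ / 2) ^ 2 := by
    rw [hδ', div_mul_eq_mul_div, div_le_iff₀ (by linarith)]
    nlinarith [sq_nonneg (δ / 2)]
  obtain ⟨h₀, hh₀, hinc⟩ := hS.exists_norm_sub_sq_le hδ'0
  have hsub : ∀ a b, 0 ≤ a → a ≤ b → b ≤ T → ∫ τ in a..b, m τ ≤ I := fun a b ha hab hb =>
    intervalIntegral.integral_mono_interval ha hab hb (Eventually.of_forall hm0)
      (hS.intervalIntegrable_norm ⟨le_rfl, hS.pos.le⟩ ⟨hS.pos.le, le_rfl⟩)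
  filter_upwards [Ioc_mem_nhdsGT hh₀] with h hh
  refine ⟨hh.1, fun t ht => ?_⟩
  rw [interpolant_eq hh.1 ht.1.le ht.2]
  have hk := floor_div_le hh.1 ht.2
  have hmem := mem_Ico_floor hh.1 ht.1.le
  have hL := memLp_semiDiscrete (hlam h hh.1) h0 hk
  refine ⟨hL.toLp, hL.coeFn_toLp, ?_⟩
  set k := ⌊t / h⌋₊ with hkdef
  have hk0 : (0 : ℝ) ≤ k * h := mul_nonneg (Nat.cast_nonneg _) hh.1.le
  have e1 := hS.norm_sub_sq_grid_le h0 hh.1 hδ'0.le (hlam h hh.1)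
    (fun a b ha hab hb hlt => hinc a b ha hab hb (hlt.trans hh.2)) k hk _ hL.coeFn_toLp
  have e2 := hinc (k * h) t hk0 hmem.1 ht.2 (by linarith [hmem.2, hh.2])
  have f1 : ‖Λ (k * h) - hL.toLp‖ ≤ δ / 2 := by
    refine abs_le_of_sq_le_sq' ?_ (by positivity) |>.2
    exact e1.trans ((mul_le_mul_of_nonneg_left
      (hsub _ _ le_rfl hk0 (hmem.1.trans ht.2)) hδ'0.le).trans hδ'I)
  have f2 : ‖Λ t - Λ (k * h)‖ ≤ δ / 2 := by
    refine abs_le_of_sq_le_sq' ?_ (by positivity) |>.2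
    exact e2.trans ((mul_le_mul_of_nonneg_left (hsub _ _ hk0 hmem.1 ht.2) hδ'0.le).trans hδ'I)
  calc ‖Λ t - hL.toLp‖ ≤ ‖Λ t - Λ (k * h)‖ + ‖Λ (k * h) - hL.toLp‖ :=
        norm_sub_le_norm_sub_add_norm_sub _ _ _
    _ ≤ δ := by linarith

/-- The weak derivatives of the semi-discrete solution. -/
noncomputable def spatialDeriv (g : ℝ → ℝ) (lam : ℕ → ℝ → ℝ) : ℕ → ℝ → ℝ
  | 0 => g
  | k + 1 => deriv (lam (k + 1))

theorem spatialDeriv_spec {T h : ℝ} (hh : 0 < h) {Λ₀ g : ℝ → ℝ} (hg : HasWeakDeriv Λ₀ g)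
    {lam : ℕ → ℝ → ℝ} (hlam : IsSemiDiscreteSolution T h Λ₀ lam) {k : ℕ} (hk : k ≤ ⌊T / h⌋₊) :
    HasWeakDeriv (lam k) (spatialDeriv g lam k) ∧
      ∀ a, angleMod (spatialDeriv g lam k) a ≤ angleMod g a := by
  induction k with
  | zero => exact ⟨hg.congr hlam.1.symm (ae_eq_refl g), fun a => le_rfl⟩
  | succ k ih =>
    obtain ⟨i1, i2⟩ := ih (by omega)
    obtain ⟨hu, hu0, ω, hω, hω2, hJ, hE⟩ := hlam.2 (k + 1) (by omega) hk
    have hw := hasWeakDeriv_of_absCont hu hu0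
    exact ⟨hw, fun a => (angleMod_le_of_step hh hw i1 hω hω2 hJ hE a).trans (i2 a)⟩

theorem transMod_spatialDeriv_le {T h : ℝ} (hh : 0 < h) {Λ₀ g : ℝ → ℝ} (hg : HasWeakDeriv Λ₀ g)
    (hgt : tvNorm g < ⊤) {lam : ℕ → ℝ → ℝ} (hlam : IsSemiDiscreteSolution T h Λ₀ lam) {k : ℕ}
    (hk : k ≤ ⌊T / h⌋₊) {a : ℝ} (ha : |a| ≤ Real.pi) :
    transMod (spatialDeriv g lam k) a ≤
      (2 * (tvNorm g + 1) + 2 * ENNReal.ofReal (2 * Real.pi)) * ENNReal.ofReal |a| := by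
  have h1 := transMod_le_of_tvNorm_le hgt le_rfl (a := a) (by linarith [Real.pi_pos])
  calc transMod (spatialDeriv g lam k) a
      ≤ angleMod (spatialDeriv g lam k) a + ENNReal.ofReal |a| * ENNReal.ofReal (2 * Real.pi) :=
        transMod_le_angleMod _ _
    _ ≤ (transMod g a + ENNReal.ofReal |a| * ENNReal.ofReal (2 * Real.pi))
          + ENNReal.ofReal |a| * ENNReal.ofReal (2 * Real.pi) := by
        gcongr
        exact ((spatialDeriv_spec hh hg hlam hk).2 a).trans (angleMod_le_transMod g a)
    _ ≤ (2 * (tvNorm g + 1) * ENNReal.ofReal |a|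
          + ENNReal.ofReal |a| * ENNReal.ofReal (2 * Real.pi))
          + ENNReal.ofReal |a| * ENNReal.ofReal (2 * Real.pi) := by gcongr
    _ = _ := by ring

/-! ### Measurability in time of the norms -/

theorem slobodeckijNorm_congr_ae {f g : ℝ → ℝ} (h : f =ᵐ[circ] g) (θ : ℝ) :
    slobodeckijNorm θ f = slobodeckijNorm θ g := by
  unfold slobodeckijNorm
  rw [eLpNorm_congr_ae h]
  congr 2
  refine lintegral_congr_ae ?_
  filter_upwards [h] with x hx
  refine lintegral_congr_ae ?_
  filter_upwards [h] with y hy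
  rw [hx, hy]

theorem sobolevNorm_eq_of_hasWeakDeriv {σ : ℝ} (hσ : 1 ≤ σ) {f g : ℝ → ℝ}
    (h : HasWeakDeriv f g) : sobolevNorm σ f = eLpNorm f 1 circ + slobodeckijNorm (σ - 1) g := by
  rw [sobolevNorm, if_neg (not_lt.2 hσ)]
  congr 1
  refine le_antisymm (iInf₂_le g h) (le_iInf₂ fun g' h' => ?_)
  rw [slobodeckijNorm_congr_ae (h.unique h')]

theorem measurable_circDist : Measurable fun z : ℝ × ℝ => circDist z.1 z.2 := by
  unfold circDist
  exact (continuous_norm.comp ((AddCircle.continuous_mk' _).comp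
    (continuous_fst.sub continuous_snd))).measurable

theorem measurable_eLpNorm_slice {H : ℝ × ℝ → ℝ} (hH : Measurable H) {p : ℝ≥0∞} (hp0 : p ≠ 0)
    (hpt : p ≠ ⊤) : Measurable fun t => eLpNorm (fun s => H (t, s)) p circ := by
  simp only [eLpNorm_eq_lintegral_rpow_enorm_toReal hp0 hpt]
  exact (hH.enorm.pow_const _).lintegral_prod_right'.pow_const _

theorem measurable_slobodeckijNorm_slice {H : ℝ × ℝ → ℝ} (hH : Measurable H) (θ : ℝ) :
    Measurable fun t => slobodeckijNorm θ fun s => H (t, s) := by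
  unfold slobodeckijNorm
  refine (measurable_eLpNorm_slice hH one_ne_zero ENNReal.one_ne_top).add ?_
  split_ifs
  · have h1 : Measurable fun z : (ℝ × ℝ) × ℝ =>
        ENNReal.ofReal |H (z.1.1, z.1.2) - H (z.1.1, z.2)| /
          ENNReal.ofReal (circDist z.1.2 z.2 ^ (1 + θ)) := by
      have h2 : Measurable fun z : (ℝ × ℝ) × ℝ => H (z.1.1, z.2) :=
        hH.comp ((measurable_fst.comp measurable_fst).prodMk measurable_snd)
      have h3 : Measurable fun z : (ℝ × ℝ) × ℝ => H (z.1.1, z.1.2) := hH.comp measurable_fst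
      have h4 : Measurable fun z : (ℝ × ℝ) × ℝ => circDist z.1.2 z.2 :=
        measurable_circDist.comp (f := fun z : (ℝ × ℝ) × ℝ => (z.1.2, z.2))
          ((measurable_snd.comp measurable_fst).prodMk measurable_snd)
      have h5 : Measurable fun z : (ℝ × ℝ) × ℝ => circDist z.1.2 z.2 ^ (1 + θ) := h4.pow_const _
      exact (h3.sub h2).norm.ennreal_ofReal.div h5.ennreal_ofReal
    exact (h1.lintegral_prod_right' (ν := circ)).lintegral_prod_right' (ν := circ)
  · exact measurable_const

/-- A norm that does not see null sets and is measurable along slices of measurable functions is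
measurable along any almost everywhere measurable family. -/
theorem aemeasurable_norm_of_joint {N : (ℝ → ℝ) → ℝ≥0∞}
    (hN : ∀ f g : ℝ → ℝ, f =ᵐ[circ] g → N f = N g)
    (hNm : ∀ H : ℝ × ℝ → ℝ, Measurable H → Measurable fun t => N fun s => H (t, s))
    {ν : Measure ℝ} [SFinite ν] {H : ℝ × ℝ → ℝ} (hH : AEStronglyMeasurable H (ν.prod circ))
    {u : ℝ → ℝ → ℝ} (hu : ∀ᵐ t ∂ν, u t =ᵐ[circ] fun s => H (t, s)) :
    AEMeasurable (fun t => N (u t)) ν := by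
  refine ⟨_, hNm _ hH.stronglyMeasurable_mk.measurable, ?_⟩
  filter_upwards [hu, Measure.ae_ae_of_ae_prod hH.ae_eq_mk] with t h1 h2
  exact hN _ _ (h1.trans h2)

theorem tendstoZeroInLp_of_uniform {T p : ℝ} (hp : 1 ≤ p) {N : (ℝ → ℝ) → ℝ≥0∞}
    {u : ℝ → ℝ → ℝ → ℝ}
    (hm : ∀ h, 0 < h → AEMeasurable (fun t => N (u h t)) (volume.restrict (Ioc 0 T)))
    (hN : ∀ δ : ℝ, 0 < δ → ∀ᶠ h in 𝓝[>] (0 : ℝ),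
      ∀ᵐ t ∂(volume.restrict (Ioc 0 T)), N (u h t) ≤ ENNReal.ofReal δ) :
    TendstoZeroInLp T p N u := by
  have hp0 : 0 < p := by linarith
  refine ⟨fun h hh => by rw [restrict_Ioo_eq_restrict_Ioc]; exact hm h hh, ?_⟩
  rw [ENNReal.tendsto_nhds_zero]
  intro ε hε
  set c : ℝ≥0∞ := ENNReal.ofReal T ^ (1 / p) with hc
  have hct : c ≠ ⊤ := ENNReal.rpow_ne_top_of_nonneg (by positivity) ENNReal.ofReal_ne_top
  have hlim : Tendsto (fun δ : ℝ => ENNReal.ofReal δ * c) (𝓝[>] 0) (𝓝 0) := by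
    have h := ((ENNReal.continuous_mul_const hct).comp ENNReal.continuous_ofReal).tendsto 0
    simp only [Function.comp_apply, ENNReal.ofReal_zero, zero_mul] at h
    exact h.mono_left nhdsWithin_le_nhds
  obtain ⟨δ, hδ, hδ0⟩ := ((hlim.eventually (ge_mem_nhds hε)).and self_mem_nhdsWithin).exists
  filter_upwards [hN δ hδ0] with h hh
  refine le_trans ?_ hδ
  rw [restrict_Ioo_eq_restrict_Ioc]
  calc (∫⁻ t in Ioc 0 T, N (u h t) ^ p) ^ (1 / p)
      ≤ (∫⁻ _ in Ioc 0 T, ENNReal.ofReal δ ^ p) ^ (1 / p) := by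
        refine ENNReal.rpow_le_rpow (lintegral_mono_ae ?_) (by positivity)
        filter_upwards [hh] with t ht using ENNReal.rpow_le_rpow ht hp0.le
    _ = ENNReal.ofReal δ * c := by
        rw [setLIntegral_const, Real.volume_Ioc, sub_zero,
          ENNReal.mul_rpow_of_nonneg _ _ (by positivity), ← ENNReal.rpow_mul,
          mul_one_div_cancel hp0.ne', ENNReal.rpow_one]

end CurvatureFlow

open CurvatureFlow

theorem lemma5 (T : ℝ) (hT : 0 < T) (Λ₀ : ℝ → ℝ)
    (Λ : ℝ → Lp ℝ 2 CurvatureFlow.circ)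
    (hΛ : CurvatureFlow.IsWeakSolution T Λ₀ Λ)
    (lam : ℝ → ℕ → ℝ → ℝ)
    (hlam : ∀ h : ℝ, 0 < h → CurvatureFlow.IsSemiDiscreteSolution T h Λ₀ (lam h)) :
    CurvatureFlow.TendstoZeroInLp T 1 (fun f => eLpNorm f 2 CurvatureFlow.circ)
      (fun h t s => Λ t s - CurvatureFlow.interpolant T h (lam h) t s) ∧
    ((∃ g : ℝ → ℝ, CurvatureFlow.HasWeakDeriv Λ₀ g ∧ CurvatureFlow.tvNorm g < ⊤) →
      ∀ p : ℝ, 1 ≤ p → ∀ ε : ℝ, 0 < ε → ε ≤ 2 →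
        CurvatureFlow.TendstoZeroInLp T p (CurvatureFlow.sobolevNorm (2 - ε))
          (fun h t s => Λ t s - CurvatureFlow.interpolant T h (lam h) t s)) := by
  obtain ⟨M, Λs, D, hS, hΛsm⟩ := hΛ.exists_isStrongSolution hT
  have h0 : Λ 0 =ᵐ[circ] Λ₀ := hΛ.2.1
  obtain ⟨u, hu, hue⟩ := exists_stronglyMeasurable_primitive hS.stronglyMeasurable (Λ 0)
  have hmem : ∀ᵐ t ∂(volume.restrict (Ioc 0 T)), t ∈ Ioc 0 T := ae_restrict_mem measurableSet_Ioc
  -- a jointly measurable representative of the error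
  have hjoint : ∀ h, 0 < h → AEStronglyMeasurable
      (fun z : ℝ × ℝ => u z - interpolant T h (lam h) z.1 z.2)
      ((volume.restrict (Ioc 0 T)).prod circ) := fun h hh =>
    hu.aestronglyMeasurable.sub (aestronglyMeasurable_interpolant
      (fun k hk => (memLp_semiDiscrete (hlam h hh) h0 hk).1) _)
  have hrep : ∀ h : ℝ, ∀ᵐ t ∂(volume.restrict (Ioc 0 T)),
      (fun s => Λ t s - interpolant T h (lam h) t s) =ᵐ[circ]
        fun s => u (t, s) - interpolant T h (lam h) t s := by
    intro h
    filter_upwards [hmem] with t ht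
    filter_upwards [hS.primitive t (Ioc_subset_Icc_self ht)] with s hs
    rw [hs, hue t ht.1.le]
  have hmeas : ∀ {N : (ℝ → ℝ) → ℝ≥0∞}, (∀ f g : ℝ → ℝ, f =ᵐ[circ] g → N f = N g) →
      (∀ H : ℝ × ℝ → ℝ, Measurable H → Measurable fun t => N fun s => H (t, s)) →
      ∀ h, 0 < h → AEMeasurable (fun t => N fun s => Λ t s - interpolant T h (lam h) t s)
        (volume.restrict (Ioc 0 T)) := fun hN hNm h hh =>
    aemeasurable_norm_of_joint hN hNm (hjoint h hh) (hrep h)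
  refine ⟨tendstoZeroInLp_of_uniform le_rfl
    (hmeas (fun f g hfg => eLpNorm_congr_ae hfg)
      fun H hH => measurable_eLpNorm_slice hH two_ne_zero ENNReal.ofNat_ne_top) fun δ hδ => ?_, ?_⟩
  · filter_upwards [hS.eventually_norm_sub_le h0 hlam hδ] with h hh
    filter_upwards [hmem] with t ht
    obtain ⟨v, hv, hle⟩ := hh.2 t ht
    have e : (fun s => Λ t s - interpolant T h (lam h) t s) =ᵐ[circ] (Λ t - v : Lp ℝ 2 circ) := by
      filter_upwards [hv, Lp.coeFn_sub (Λ t) v] with s h1 h2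
      rw [h2, Pi.sub_apply, h1]
    rw [eLpNorm_congr_ae e, ← Lp.enorm_def, ← ofReal_norm]
    exact ENNReal.ofReal_le_ofReal hle
  rintro ⟨g, hg, hgt⟩ p hp ε hε hε2
  -- the error is weakly differentiable at almost every time
  have hwd : ∀ h, 0 < h → ∀ᵐ t ∂(volume.restrict (Ioc 0 T)),
      HasWeakDeriv (fun s => Λ t s - interpolant T h (lam h) t s)
        (fun s => Λs t s - interpolant T h (spatialDeriv g (lam h)) t s) := by
    intro h hh
    filter_upwards [hS.hasWeakDeriv, hmem] with t h1 ht
    rw [interpolant_eq hh ht.1.le ht.2, interpolant_eq hh ht.1.le ht.2]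
    exact h1.sub (spatialDeriv_spec hh hg (hlam h hh) (floor_div_le hh ht.2)).1
  refine tendstoZeroInLp_of_uniform hp (fun h hh => ?_) fun δ hδ => ?_
  · rcases lt_or_ge (2 - ε) 1 with hσ | hσ
    · simp only [sobolevNorm, if_pos hσ]
      exact hmeas (fun f g hfg => slobodeckijNorm_congr_ae hfg _)
        (fun H hH => measurable_slobodeckijNorm_slice hH _) h hh
    · have h1 := hmeas (N := fun f => eLpNorm f 1 circ) (fun f g hfg => eLpNorm_congr_ae hfg)
        (fun H hH => measurable_eLpNorm_slice hH one_ne_zero ENNReal.one_ne_top) h hh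
      have h2 : AEMeasurable (fun t => slobodeckijNorm (2 - ε - 1)
          fun s => Λs t s - interpolant T h (spatialDeriv g (lam h)) t s) (volume.restrict (Ioc 0 T)) :=
        aemeasurable_norm_of_joint (fun f g hfg => slobodeckijNorm_congr_ae hfg _)
          (fun H hH => measurable_slobodeckijNorm_slice hH _)
          (hΛsm.sub (aestronglyMeasurable_interpolant
            (fun k hk => (spatialDeriv_spec hh hg (hlam h hh) hk).1.2.1.1) _))
          (Eventually.of_forall fun t => ae_eq_refl _)
      refine (h1.add h2).congr ?_
      filter_upwards [hwd h hh] with t ht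
      exact (sobolevNorm_eq_of_hasWeakDeriv hσ ht).symm
  · set C : ℝ≥0∞ := 2 * (M + 1) + (2 * (tvNorm g + 1) + 2 * ENNReal.ofReal (2 * Real.pi)) with hC
    have hCt : C < ⊤ := by
      have h1 := hS.lt_top
      simp only [hC, ENNReal.add_lt_top]
      exact ⟨ENNReal.mul_lt_top (by simp) (ENNReal.add_lt_top.2 ⟨h1, by simp⟩),
        ENNReal.mul_lt_top (by simp) (ENNReal.add_lt_top.2 ⟨hgt, by simp⟩),
        ENNReal.mul_lt_top (by simp) ENNReal.ofReal_lt_top⟩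
    obtain ⟨A, hA, HA⟩ := exists_sobolevNorm_le (σ := 2 - ε) (by linarith) (by linarith) hCt hδ
    have hs0 : 0 < Real.sqrt (2 * Real.pi) := Real.sqrt_pos.2 Real.two_pi_pos
    filter_upwards [hS.eventually_norm_sub_le h0 hlam (div_pos hA hs0)] with h hh
    filter_upwards [hwd h hh.1, hS.hasWeakDeriv, hS.tvNorm_le, hmem] with t h1 h2 h3 ht
    refine HA _ _ h1 (fun a ha => ?_) ?_
    · rw [interpolant_eq hh.1 ht.1.le ht.2]
      calc _ ≤ transMod (Λs t) a + transMod (spatialDeriv g (lam h) ⌊t / h⌋₊) a :=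
            transMod_sub_le h2.2.1 a
        _ ≤ 2 * (M + 1) * ENNReal.ofReal |a| + (2 * (tvNorm g + 1) +
              2 * ENNReal.ofReal (2 * Real.pi)) * ENNReal.ofReal |a| :=
            add_le_add (transMod_le_of_tvNorm_le hS.lt_top h3 (by linarith [Real.pi_pos]))
              (transMod_spatialDeriv_le hh.1 hg hgt (hlam h hh.1) (floor_div_le hh.1 ht.2) ha)
        _ = C * ENNReal.ofReal |a| := by rw [hC]; ring
    · obtain ⟨v, hv, hle⟩ := hh.2 t ht
      have e : (fun s => Λ t s - interpolant T h (lam h) t s) =ᵐ[circ]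
          (Λ t - v : Lp ℝ 2 circ) := by
        filter_upwards [hv, Lp.coeFn_sub (Λ t) v] with s h1 h2
        rw [h2, Pi.sub_apply, h1]
      rw [eLpNorm_congr_ae e, eLpNorm_one_eq_lintegral_enorm,
        ← ofReal_integral_norm_eq_lintegral_enorm (lp_integrable _)]
      refine ENNReal.ofReal_le_ofReal ((integral_abs_le_norm _).trans ?_)
      rw [le_div_iff₀ hs0] at hle
      linarith
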